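/- **Setting.** Let $v>0$ and let $(z_t)_{t\ge 1}$ be white noise with variance $v$ (centred, square integrable, pairwise uncorrelated, $\operatorname{Var} z_t=v$). Fix $\rho\in(-1,1)\setminus\{0\}$ and put $\mathcal E_\rho=(0,\infty)$ if $\rho>0$, $\mathcal E_\rho=(-\infty,0)$ if $\rho<0$. Given $m\ge 0$, magnitudes $\underline\varepsilon=(\varepsilon_1,\dots,\varepsilon_m)\in\mathcal E_\rho^{m}$ and, for each $n$, break points $k_1<\dots<k_m$ in $\{1,\dots,n\}$ (depending on $n$, and required only for all large $n$), let $y_0=0$ and $$y_t=\rho_t y_{t-1}+z_t,\qquad \rho_t=\rho+\sum_{j=1}^m\varepsilon_j\,\mathbf 1_{\{k_j\}}(t)\qquad(t\ge 1),$$ and let $B_n$ be the precision matrix of $(y_1,\dots,y_n)$, i.e. the inverse of its covariance matrix. Assume that $k_1$, all the differences $k_{j+1}-k_j$, and $n-k_m$ tend to infinity as $n\to\infty$ (no condition if $m=0$). For a sequence $(A_n)$ of real symmetric $n\times n$ matrices whose empirical spectral distributions $\frac1n\sum_{i=1}^n\delta_{\lambda_i(A_n)}$ converge weakly to a compactly supported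 probability measure $\mu$, a point $x\in\mathbb R$ is an outlier if $x\notin\operatorname{supp}\mu$ and $\operatorname{dist}(x,\operatorname{spec}(A_n))\to 0$. Its multiplicity is the largest $c$ such that for every $\delta>0$ and all sufficiently large $n$ at least $c$ eigenvalues of $A_n$, counted with multiplicity, lie within $\delta$ of $x$. Write $out(\{A_n\})$ for the multiset of outliers. **Proposition.** Let $(m_1,\underline\varepsilon_1)$ and $(m_2,\underline\varepsilon_2)$, with $m_i\in\mathbb Z_{\ge 0}$ and $\underline\varepsilon_i\in\mathcal E_\rho^{m_i}$, be two parameter choices with the same $\rho$ and $v$, each with break points as above (possibly different for the two choices), and let $B_n^{(1)},B_n^{(2)}$ be the corresponding precision matrices. If $out(\{B_n^{(1)}\})=out(\{B_n^{(2)}\})$ as multisets, then $m_1=m_2$ and there is a permutation $\sigma\in S_{m_1}$ such that $(\underline\varepsilon_2)_j=(\underline\varepsilon_1)_{\sigma(j)}$ for all $1\le j\le m_1$. -/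

import Mathlib

open MeasureTheory ProbabilityTheory Filter Topology

noncomputable section

/-- `z 1, z 2, …` is a white noise with variance `v` under `P`: centred, square integrable,
of variance `v`, pairwise uncorrelated. -/
structure IsWhiteNoise {Ω : Type*} [MeasurableSpace Ω] (P : Measure Ω)
    (z : ℕ → Ω → ℝ) (v : ℝ) : Prop where
  memLp : ∀ t, 1 ≤ t → MemLp (z t) 2 P
  mean_eq_zero : ∀ t, 1 ≤ t → ∫ ω, z t ω ∂P = 0
  variance_eq : ∀ t, 1 ≤ t → variance (z t) P = v
  uncorrelated : ∀ s t, 1 ≤ s → 1 ≤ t → s ≠ t → covariance (z s) (z t) P = 0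

/-- The autoregressive process with `y 0 = 0` and `y t = r t * y (t - 1) + z t` for `t ≥ 1`. -/
def arProcess {Ω : Type*} (r : ℕ → ℝ) (z : ℕ → Ω → ℝ) : ℕ → Ω → ℝ
  | 0 => fun _ => 0
  | t + 1 => fun ω => r (t + 1) * arProcess r z t ω + z (t + 1) ω

/-- The precision matrix of `(y 1, …, y n)`, that is the inverse of its covariance matrix
(the index `i : Fin n` stands for the time `i + 1`). -/
def precisionMatrix {Ω : Type*} [MeasurableSpace Ω] (P : Measure Ω) (y : ℕ → Ω → ℝ) (n : ℕ) :
    Matrix (Fin n) (Fin n) ℝ :=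
  (Matrix.of fun i j : Fin n => covariance (y (i + 1)) (y (j + 1)) P)⁻¹

/-- The coefficients `ρ_t = ρ + ∑ j, ε j * 1_{E j}(t)` of the structural change model, where
`E j = {k j, k j + 1, …, k j + h j - 1}` has break point `k j` and length `h j`. -/
def scmCoeff (ρ : ℝ) {m : ℕ} (ε : Fin m → ℝ) (k h : Fin m → ℕ) (t : ℕ) : ℝ :=
  ρ + ∑ j, (Set.Ico (k j) (k j + h j)).indicator (fun _ => ε j) t

/-- The sequence `n ↦ B_n` of precision matrices of the structural change model; the break points
`k n` may move with the number `n` of observations. -/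
def scmPrecision {Ω : Type*} [MeasurableSpace Ω] (P : Measure Ω) (z : ℕ → Ω → ℝ)
    (ρ : ℝ) {m : ℕ} (ε : Fin m → ℝ) (k : ℕ → Fin m → ℕ) (h : Fin m → ℕ) (n : ℕ) :
    Matrix (Fin n) (Fin n) ℝ :=
  precisionMatrix P (arProcess (scmCoeff ρ ε (k n) h) z) n

/-- The changed intervals lie in order in `{1, …, n}` for all large `n`, and the gaps before the
first one, between any two of them, and after the last one tend to infinity with `n`. -/
def WellSpaced {m : ℕ} (k : ℕ → Fin m → ℕ) (h : Fin m → ℕ) : Prop :=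
  ∀ D : ℕ, ∀ᶠ n in atTop,
    (∀ j, D ≤ k n j) ∧
    (∀ i j, i < j → k n i + h i + D ≤ k n j) ∧
    (∀ j, k n j + h j + D ≤ n)

/-- The admissible magnitudes of change: `(0, ∞)` if `ρ > 0` and `(-∞, 0)` otherwise. -/
def magnitudes (ρ : ℝ) : Set ℝ := if 0 < ρ then Set.Ioi 0 else Set.Iio 0

/-- The empirical spectral distribution `(1/n) ∑ i, δ_{λ_i(A)}`; for a real symmetric matrix the
roots of the characteristic polynomial are the `n` eigenvalues counted with multiplicity. -/
def esd {n : ℕ} (A : Matrix (Fin n) (Fin n) ℝ) : Measure ℝ :=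
  (n : ENNReal)⁻¹ • (A.charpoly.roots.map fun x => Measure.dirac x).sum

/-- `μ` is the asymptotic spectral distribution of the sequence `A`: a probability measure to
which the empirical spectral distributions converge weakly. -/
def IsASD (A : ∀ n, Matrix (Fin n) (Fin n) ℝ) (μ : Measure ℝ) : Prop :=
  IsProbabilityMeasure μ ∧
    ∀ f : BoundedContinuousFunction ℝ ℝ,
      Tendsto (fun n => ∫ x, f x ∂(esd (A n))) atTop (𝓝 (∫ x, f x ∂μ))

/-- `x` is an outlier of the sequence `A`: `A` has a compactly supported asymptotic spectral
distribution, `x` is not in the closure of its support, and the distance from `x` to the spectrum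
of `A n` tends to `0`. -/
def IsOutlier (A : ∀ n, Matrix (Fin n) (Fin n) ℝ) (x : ℝ) : Prop :=
  (∃ μ : Measure ℝ, IsASD A μ ∧ IsCompact μ.support ∧ x ∉ closure μ.support) ∧
    Tendsto (fun n => Metric.infDist x (spectrum ℝ (A n))) atTop (𝓝 0)

/-- The number of eigenvalues of `A`, counted with multiplicity, at distance less than `δ`
from `x`. -/
def eigenvalueCount {n : ℕ} (A : Matrix (Fin n) (Fin n) ℝ) (x δ : ℝ) : ℕ :=
  (A.charpoly.roots.filter fun y => |x - y| < δ).card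

open Classical in
/-- The multiset of outliers of the sequence `A`, as the function giving each real its
multiplicity: `0` if `x` is not an outlier, and otherwise the largest `c` such that, however small
`δ > 0`, for all large `n` at least `c` eigenvalues of `A n` are within `δ` of `x`. -/
def out (A : ∀ n, Matrix (Fin n) (Fin n) ℝ) (x : ℝ) : ℕ∞ :=
  if IsOutlier A x then
    ⨆ (c : ℕ) (_ : ∀ δ : ℝ, 0 < δ → ∀ᶠ n in atTop, c ≤ eigenvalueCount (A n) x δ), (c : ℕ∞)
  else 0

end

/-! The precision matrix is `v⁻¹ MᵀM` with `M` bidiagonal, hence tridiagonal and Toeplitz except at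
the last corner and near the breaks. Its bulk is the range of the symbol `v⁻¹ |1 - ρ e^{iθ}|²`,
which lies above `v⁻¹ (1 - |ρ|)²`. A break turning the coefficient into `b = ρ + ε`, with `b² > ρ²`,
binds a state below the bulk: it decays geometrically with ratio `ρ / w` on both sides, where `w` is
the positive root of `w² + (b² - ρ²) w = b²`. Its energy determines `ε` (`lowOutlier_injOn`), so the
outliers below the bulk suffice.

Multiplicities come from two opposite bounds. Truncated bound states at distant breaks are
approximate eigenvectors, giving at least as many eigenvalues near an outlier as there are breaks of
that magnitude (`eventually_card_le_eigenvalueCount`). A vector vanishing just before each of the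
`m` breaks does not feel them, so at most `m` eigenvalues lie below the bulk
(`eventually_card_roots_lt_le`). The lower bounds already add up to `m`, so all of them are sharp.

The definition of an outlier also requires a limiting spectral law, which the method of moments
provides (`exists_isASD_arMatrix`). The outliers thus record how often each magnitude occurs, that
is, the magnitudes up to permutation. -/

/-! ### The difference operator and its transpose. -/

/-- The matrix of the difference operator `x ↦ (x t - r t * x (t - 1))_t` on `{1, …, n}`, with the
convention `x 0 = 0`. -/
def diffMatrix (r : ℕ → ℝ) (n : ℕ) : Matrix (Fin n) (Fin n) ℝ :=
  Matrix.of fun i j => (if i = j then 1 else 0) - (if (i : ℕ) = j + 1 then r (i + 1) else 0)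

theorem sum_fin_shift_down {n : ℕ} (i : Fin n) (f : ℕ → ℝ) (c : ℝ) (hf : f 0 = 0) :
    ∑ j : Fin n, (if (i : ℕ) = j + 1 then c else 0) * f (j + 1) = c * f i := by
  obtain ⟨i, hi⟩ := i
  rcases i with _ | i
  · simp [hf]
  · rw [Finset.sum_eq_single (⟨i, by omega⟩ : Fin n)]
    · simp
    · intro j _ hj
      have : ¬ (i = (j : ℕ)) := fun h => hj (Fin.ext h.symm)
      simp [this]
    · simp

theorem diffMatrix_mulVec {r : ℕ → ℝ} {n : ℕ} {f : ℕ → ℝ} (hf : f 0 = 0) (i : Fin n) :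
    ∑ j : Fin n, diffMatrix r n i j * f (j + 1) = f (i + 1) - r (i + 1) * f i := by
  simp only [diffMatrix, Matrix.of_apply, sub_mul, Finset.sum_sub_distrib]
  rw [sum_fin_shift_down i f _ hf]
  simp

/-- The transpose shifts forward and runs off the end at the last index; the condition at `n + 1`
keeps the formula uniform there. -/
theorem diffMatrix_transpose_mulVec {r : ℕ → ℝ} {n : ℕ} {w : ℕ → ℝ} (hw : w (n + 1) = 0)
    (i : Fin n) :
    ∑ j : Fin n, diffMatrix r n j i * w (j + 1) = w (i + 1) - r (i + 2) * w (i + 2) := by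
  simp only [diffMatrix, Matrix.of_apply, sub_mul, Finset.sum_sub_distrib]
  congr 1
  · simp
  · by_cases h : (i : ℕ) + 1 < n
    · rw [Finset.sum_eq_single (⟨i + 1, h⟩ : Fin n)]
      · simp
      · intro j _ hj
        have : ¬ ((j : ℕ) = i + 1) := fun h => hj (Fin.ext h)
        simp [this]
      · simp
    · have hi : (i : ℕ) + 1 = n := by omega
      rw [show (i : ℕ) + 2 = n + 1 by omega, hw, mul_zero]
      refine Finset.sum_eq_zero fun j _ => ?_
      rw [if_neg (by omega), zero_mul]

/-! ### Factorization of the precision matrix. -/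

section Precision

variable {Ω : Type*} [MeasurableSpace Ω] {P : Measure Ω}
  {z : ℕ → Ω → ℝ} {v : ℝ}

theorem IsWhiteNoise.memLp_arProcess (hz : IsWhiteNoise P z v) (r : ℕ → ℝ) (t : ℕ) :
    MemLp (arProcess r z t) 2 P := by
  induction t with
  | zero => exact MemLp.zero
  | succ t ih => exact (ih.const_mul (r (t + 1))).add (hz.memLp (t + 1) (by omega))

theorem IsWhiteNoise.covariance_innovation [IsFiniteMeasure P] (hz : IsWhiteNoise P z v) (r : ℕ → ℝ) (t : ℕ)
    {Y : Ω → ℝ} (hY : MemLp Y 2 P) :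
    covariance (arProcess r z (t + 1)) Y P - r (t + 1) * covariance (arProcess r z t) Y P =
      covariance (z (t + 1)) Y P := by
  have h : arProcess r z (t + 1) = (fun ω => r (t + 1) * arProcess r z t ω) + z (t + 1) := rfl
  rw [h, covariance_add_left ((hz.memLp_arProcess r t).const_mul _) (hz.memLp _ (by omega)) hY,
    covariance_const_mul_left]
  ring

/-- The difference operator `M` turns the process into its innovations, so `M S Mᵀ = v • 1` for the
covariance matrix `S`; inverting gives the factorization. -/
theorem IsWhiteNoise.precisionMatrix_arProcess [IsProbabilityMeasure P] (hz : IsWhiteNoise P z v)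
    (hv : 0 < v) (r : ℕ → ℝ) (n : ℕ) :
    precisionMatrix P (arProcess r z) n = v⁻¹ • ((diffMatrix r n).transpose * diffMatrix r n) := by
  set M := diffMatrix r n
  set S : Matrix (Fin n) (Fin n) ℝ := Matrix.of fun i j : Fin n =>
    covariance (arProcess r z (i + 1)) (arProcess r z (j + 1)) P with hS
  have h0 : ∀ Y : Ω → ℝ, covariance (arProcess r z 0) Y P = 0 := fun Y => by
    simp [arProcess]
  have h0' : ∀ Y : Ω → ℝ, covariance Y (arProcess r z 0) P = 0 := fun Y => by
    simp [arProcess]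
  have h1 : ∀ i j : Fin n, (M * S) i j = covariance (z (i + 1)) (arProcess r z (j + 1)) P := by
    intro i j
    rw [Matrix.mul_apply]
    have := diffMatrix_mulVec (r := r) (n := n)
      (f := fun t => covariance (arProcess r z t) (arProcess r z (j + 1)) P) (h0 _) i
    simp only [hS, Matrix.of_apply]
    rw [this, hz.covariance_innovation r _ (hz.memLp_arProcess r _)]
  have h2 : M * S * M.transpose = v • (1 : Matrix (Fin n) (Fin n) ℝ) := by
    ext i j
    rw [Matrix.mul_apply]
    simp only [h1, Matrix.transpose_apply]
    have := diffMatrix_mulVec (r := r) (n := n)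
      (f := fun t => covariance (z (i + 1)) (arProcess r z t) P) (h0' _) j
    simp only [mul_comm _ (M j _)]
    rw [this, covariance_comm, covariance_comm (z (i + 1)) (arProcess r z j),
      hz.covariance_innovation r _ (hz.memLp _ (by omega))]
    by_cases hij : i = j
    · subst hij
      rw [covariance_self (hz.memLp _ (by omega)).aestronglyMeasurable.aemeasurable,
        hz.variance_eq _ (by omega)]
      simp
    · rw [hz.uncorrelated _ _ (by omega) (by omega)]
      · simp [hij]
      · intro h; exact hij (Fin.ext (by omega))
  have h3 : M * (v⁻¹ • (S * M.transpose)) = 1 := by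
    rw [Matrix.mul_smul, ← Matrix.mul_assoc, h2, smul_smul, inv_mul_cancel₀ hv.ne', one_smul]
  -- One-sided inverses of square matrices are two-sided, so no determinant is needed.
  have h4 : (v⁻¹ • (S * M.transpose)) * M = 1 := mul_eq_one_comm.mp h3
  refine Matrix.inv_eq_right_inv ?_
  rw [Matrix.mul_smul, ← Matrix.mul_assoc, ← Matrix.smul_mul]
  exact h4

end Precision

/-! ### Eigenvalue counting by dimension arguments. -/

section Spectral

open Matrix

/-- Real spectral theorem, in terms of matrices and of the roots of the characteristic
polynomial. -/
theorem exists_orthogonal_diagonalization {n : ℕ} {A : Matrix (Fin n) (Fin n) ℝ}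
    (hA : A.IsHermitian) :
    ∃ (U : Matrix (Fin n) (Fin n) ℝ) (d : Fin n → ℝ), Uᵀ * U = 1 ∧ U * Uᵀ = 1 ∧
      A = U * diagonal d * Uᵀ ∧ A.charpoly.roots = Finset.univ.val.map d := by
  refine ⟨hA.eigenvectorUnitary, hA.eigenvalues, ?_, ?_, ?_, ?_⟩
  · simpa [star_eq_conjTranspose] using Unitary.coe_star_mul_self hA.eigenvectorUnitary
  · simpa [star_eq_conjTranspose] using Unitary.coe_mul_star_self hA.eigenvectorUnitary
  · conv_lhs => rw [hA.spectral_theorem]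
    rw [Unitary.conjStarAlgAut_apply]
    simp [star_eq_conjTranspose]
  · rw [hA.roots_charpoly_eq_eigenvalues]
    rfl

variable {n : ℕ} {U : Matrix (Fin n) (Fin n) ℝ} {d : Fin n → ℝ} {A : Matrix (Fin n) (Fin n) ℝ}

theorem dotProduct_mulVec_orthogonal (hU : Uᵀ * U = 1) (c e : Fin n → ℝ) :
    (U *ᵥ c) ⬝ᵥ (U *ᵥ e) = c ⬝ᵥ e := by
  rw [dotProduct_mulVec, ← mulVec_transpose, mulVec_mulVec, hU, one_mulVec]

theorem mulVec_sub_smul_of_diagonalization (hU : Uᵀ * U = 1) (hA : A = U * diagonal d * Uᵀ)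
    (x : ℝ) (c : Fin n → ℝ) :
    A *ᵥ (U *ᵥ c) - x • (U *ᵥ c) = U *ᵥ (fun i => (d i - x) * c i) := by
  rw [mulVec_mulVec, hA, Matrix.mul_assoc, hU, Matrix.mul_one, ← mulVec_mulVec, ← mulVec_smul,
    ← mulVec_sub]
  congr 1
  ext i
  simp [mulVec_diagonal, sub_mul]

theorem exists_ne_zero_of_card_lt {ι κ : Type*} [Fintype ι] [Fintype κ]
    (f : (ι → ℝ) →ₗ[ℝ] (κ → ℝ)) (h : Fintype.card κ < Fintype.card ι) :
    ∃ a, a ≠ 0 ∧ f a = 0 := by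
  have := LinearMap.ker_ne_bot_of_finrank_lt (f := f) (by simpa using h)
  obtain ⟨a, ha, ha0⟩ := Submodule.exists_mem_ne_zero_of_ne_bot this
  exact ⟨a, ha0, ha⟩

theorem card_filter_roots (hr : A.charpoly.roots = Finset.univ.val.map d) (p : ℝ → Prop)
    [DecidablePred p] :
    (A.charpoly.roots.filter p).card = Fintype.card {i // p (d i)} := by
  rw [hr, Multiset.filter_map, Multiset.card_map, Fintype.card_subtype]
  rfl

/-- If `A - x` is shorter than `δ` on the nonzero vectors of an `|ι|`-dimensional space, then `A`
has at least `|ι|` eigenvalues within `δ` of `x`. -/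
theorem card_le_eigenvalueCount {ι : Type*} [Fintype ι] (hA : A.IsHermitian) {x δ : ℝ} (hδ : 0 ≤ δ)
    (φ : ι → Fin n → ℝ)
    (hφ : ∀ a : ι → ℝ, a ≠ 0 →
      (A *ᵥ (∑ j, a j • φ j) - x • ∑ j, a j • φ j) ⬝ᵥ
        (A *ᵥ (∑ j, a j • φ j) - x • ∑ j, a j • φ j) <
      δ ^ 2 * ((∑ j, a j • φ j) ⬝ᵥ (∑ j, a j • φ j))) :
    Fintype.card ι ≤ eigenvalueCount A x δ := by
  obtain ⟨U, d, hU, hU', hAU, hr⟩ := exists_orthogonal_diagonalization hA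
  rw [eigenvalueCount, card_filter_roots hr]
  by_contra! hlt
  -- Coordinates along the eigenvectors with eigenvalue near `x`. If these are too few, some nonzero
  -- combination has none of them, and `A - x` stretches it by at least `δ`.
  let f : (ι → ℝ) →ₗ[ℝ] ({i // |x - d i| < δ} → ℝ) :=
    { toFun := fun a i => (Uᵀ *ᵥ (∑ j, a j • φ j)) i
      map_add' := fun a b => by
        ext i
        simp [add_smul, Finset.sum_add_distrib, mulVec_add]
      map_smul' := fun c a => by
        ext i
        simp [mul_smul, ← Finset.smul_sum, mulVec_smul] }
  obtain ⟨a, ha, hfa⟩ := exists_ne_zero_of_card_lt f hlt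
  have h := hφ a ha
  set y := ∑ j, a j • φ j with hy
  have hyU : y = U *ᵥ (Uᵀ *ᵥ y) := by rw [mulVec_mulVec, hU', one_mulVec]
  have hz : ∀ i, |x - d i| < δ → (Uᵀ *ᵥ y) i = 0 := fun i hi => congrFun hfa ⟨i, hi⟩
  set c := Uᵀ *ᵥ y
  rw [hyU, mulVec_sub_smul_of_diagonalization hU hAU, dotProduct_mulVec_orthogonal hU,
    dotProduct_mulVec_orthogonal hU] at h
  refine absurd h (not_lt.mpr ?_)
  rw [dotProduct, dotProduct, Finset.mul_sum]
  refine Finset.sum_le_sum fun i _ => ?_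
  by_cases hi : |x - d i| < δ
  · simp [hz i hi]
  · have h1 : δ ^ 2 ≤ (d i - x) ^ 2 := by
      rw [← sq_abs (d i - x), abs_sub_comm]
      exact pow_le_pow_left₀ hδ (not_lt.mp hi) 2
    nlinarith [mul_le_mul_of_nonneg_right h1 (sq_nonneg (c i))]

/-- If the quadratic form of `A` is at least `a` on the vectors vanishing at `m` given sites, then
at most `m` eigenvalues of `A` are smaller than `a`. -/
theorem card_roots_lt_le {m : ℕ} (hA : A.IsHermitian) {a : ℝ} (s : Fin m → Fin n)
    (h : ∀ y : Fin n → ℝ, (∀ j, y (s j) = 0) → a * (y ⬝ᵥ y) ≤ y ⬝ᵥ (A *ᵥ y)) :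
    (A.charpoly.roots.filter (· < a)).card ≤ m := by
  classical
  obtain ⟨U, d, hU, hU', hAU, hr⟩ := exists_orthogonal_diagonalization hA
  rw [card_filter_roots hr]
  by_contra! hlt
  let e : ({i // d i < a} → ℝ) → Fin n → ℝ := fun c i => if hi : d i < a then c ⟨i, hi⟩ else 0
  let f : ({i // d i < a} → ℝ) →ₗ[ℝ] (Fin m → ℝ) :=
    { toFun := fun c j => (U *ᵥ e c) (s j)
      map_add' := fun c b => by
        have : e (c + b) = e c + e b := by
          ext i; by_cases hi : d i < a <;> simp [e, hi]
        ext j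
        simp [this, mulVec_add]
      map_smul' := fun t c => by
        have : e (t • c) = t • e c := by
          ext i; by_cases hi : d i < a <;> simp [e, hi]
        ext j
        simp [this, mulVec_smul] }
  -- More than `m` low eigenvectors would have a nontrivial combination vanishing at all `m` sites,
  -- yet its form is strictly below `a`.
  obtain ⟨c, hc, hfc⟩ := exists_ne_zero_of_card_lt f (by simpa using hlt)
  have h1 := h (U *ᵥ e c) (fun j => congrFun hfc j)
  have h2 := mulVec_sub_smul_of_diagonalization hU hAU 0 (e c)
  rw [zero_smul, sub_zero] at h2
  rw [h2, dotProduct_mulVec_orthogonal hU, dotProduct_mulVec_orthogonal hU] at h1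
  refine absurd h1 (not_le.mpr ?_)
  rw [dotProduct, dotProduct, Finset.mul_sum]
  have hle : ∀ i, e c i * ((d i - 0) * e c i) ≤ a * (e c i * e c i) := by
    intro i
    by_cases hi : d i < a
    · nlinarith [mul_nonneg (sub_nonneg.mpr hi.le) (mul_self_nonneg (e c i))]
    · simp [e, hi]
  obtain ⟨⟨i, hi⟩, hci⟩ := Function.ne_iff.mp hc
  refine Finset.sum_lt_sum (fun i _ => hle i) ⟨i, Finset.mem_univ _, ?_⟩
  have hei : e c i = c ⟨i, hi⟩ := by simp [e, hi]
  rw [hei]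
  have : 0 < c ⟨i, hi⟩ * c ⟨i, hi⟩ := mul_self_pos.mpr hci
  nlinarith [mul_pos (sub_pos.mpr hi) this]

/-- If the quadratic form of `A` is between `0` and `C`, so are the eigenvalues. -/
theorem mem_Icc_of_diagonalization {C : ℝ}
    (h0 : ∀ y : Fin n → ℝ, 0 ≤ y ⬝ᵥ (A *ᵥ y)) (hC : ∀ y : Fin n → ℝ, y ⬝ᵥ (A *ᵥ y) ≤ C * (y ⬝ᵥ y))
    (hU : Uᵀ * U = 1) (hAU : A = U * diagonal d * Uᵀ) (i : Fin n) : d i ∈ Set.Icc 0 C := by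
  have h2 := mulVec_sub_smul_of_diagonalization hU hAU 0 (Pi.single i 1)
  rw [zero_smul, sub_zero] at h2
  have h3 := h0 (U *ᵥ Pi.single i 1)
  have h4 := hC (U *ᵥ Pi.single i 1)
  rw [h2, dotProduct_mulVec_orthogonal hU] at h3 h4
  rw [dotProduct_mulVec_orthogonal hU] at h4
  simp at h3 h4
  exact ⟨h3, h4⟩

theorem pow_of_diagonalization (hU : Uᵀ * U = 1) (hU' : U * Uᵀ = 1)
    (hAU : A = U * diagonal d * Uᵀ) (k : ℕ) :
    A ^ k = U * diagonal (fun i => d i ^ k) * Uᵀ := by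
  induction k with
  | zero => simp [hU']
  | succ k ih =>
    rw [pow_succ, ih, hAU]
    calc U * diagonal (fun i => d i ^ k) * Uᵀ * (U * diagonal d * Uᵀ)
        = U * diagonal (fun i => d i ^ k) * (Uᵀ * U) * diagonal d * Uᵀ := by
          simp only [Matrix.mul_assoc]
      _ = _ := by
          rw [hU, Matrix.mul_one, Matrix.mul_assoc U, diagonal_mul_diagonal]
          simp only [pow_succ]

theorem trace_pow_of_diagonalization (hU : Uᵀ * U = 1) (hU' : U * Uᵀ = 1)
    (hAU : A = U * diagonal d * Uᵀ) (k : ℕ) :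
    (A ^ k).trace = ∑ i, d i ^ k := by
  rw [pow_of_diagonalization hU hU' hAU, trace_mul_comm, ← Matrix.mul_assoc, hU, Matrix.one_mul,
    trace_diagonal]

/-- The rows of `U` are unit vectors, so a diagonal entry of `A ^ k` is a convex combination of the
`d j ^ k`. -/
theorem abs_pow_apply_self_le (hU : Uᵀ * U = 1) (hU' : U * Uᵀ = 1)
    (hAU : A = U * diagonal d * Uᵀ) {C : ℝ} (hd : ∀ i, d i ∈ Set.Icc 0 C) (k : ℕ) (t : Fin n) :
    |(A ^ k) t t| ≤ C ^ k := by
  have h1 : ∑ j, U t j * U t j = 1 := by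
    have := congrFun (congrFun hU' t) t
    simpa [Matrix.mul_apply] using this
  have h2 : (A ^ k) t t = ∑ j, d j ^ k * (U t j * U t j) := by
    rw [pow_of_diagonalization hU hU' hAU, Matrix.mul_apply]
    refine Finset.sum_congr rfl fun j _ => ?_
    rw [mul_diagonal, transpose_apply]
    ring
  have h3 : 0 ≤ (A ^ k) t t := by
    rw [h2]
    exact Finset.sum_nonneg fun j _ => mul_nonneg (pow_nonneg (hd j).1 k) (mul_self_nonneg _)
  rw [abs_of_nonneg h3, h2]
  calc ∑ j, d j ^ k * (U t j * U t j) ≤ ∑ j, C ^ k * (U t j * U t j) :=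
        Finset.sum_le_sum fun j _ => mul_le_mul_of_nonneg_right
          (pow_le_pow_left₀ (hd j).1 (hd j).2 k) (mul_self_nonneg _)
    _ = C ^ k := by rw [← Finset.mul_sum, h1, mul_one]

end Spectral

/-! ### The quadratic form and its bounds. -/

section Form

open Matrix

/-- The matrix `v⁻¹ MᵀM`, where `M` is the difference operator with coefficients `r`. -/
noncomputable def arMatrix (v : ℝ) (r : ℕ → ℝ) (n : ℕ) : Matrix (Fin n) (Fin n) ℝ :=
  v⁻¹ • ((diffMatrix r n)ᵀ * diffMatrix r n)

variable {v : ℝ} {r : ℕ → ℝ} {n : ℕ}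

theorem arMatrix_isHermitian (v : ℝ) (r : ℕ → ℝ) (n : ℕ) : (arMatrix v r n).IsHermitian := by
  rw [Matrix.IsHermitian, conjTranspose_eq_transpose_of_trivial, arMatrix, transpose_smul,
    transpose_mul, transpose_transpose]

/-- Extension of a vector by zero to all times; the index `i` stands for the time `i + 1`. -/
noncomputable def extendZero (y : Fin n → ℝ) (t : ℕ) : ℝ :=
  if h : 1 ≤ t ∧ t ≤ n then y ⟨t - 1, by omega⟩ else 0

theorem extendZero_zero (y : Fin n → ℝ) : extendZero y 0 = 0 := by simp [extendZero]

theorem extendZero_succ (y : Fin n → ℝ) (i : Fin n) : extendZero y (i + 1) = y i := by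
  simp [extendZero]

theorem arMatrix_mulVec_apply {x : ℕ → ℝ} (hx : x 0 = 0) (i : Fin n) :
    (arMatrix v r n *ᵥ fun j : Fin n => x (j + 1)) i =
      v⁻¹ * (x (i + 1) - r (i + 1) * x i -
        if (i : ℕ) + 1 < n then r (i + 2) * (x (i + 2) - r (i + 2) * x (i + 1)) else 0) := by
  -- The residual is set to zero after time `n`, as the transpose formula demands; `x` itself is
  -- arbitrary there. This causes the case split in the last row.
  have h1 : (diffMatrix r n *ᵥ fun j : Fin n => x (j + 1)) =
      fun i : Fin n => (fun t => if t ≤ n then x t - r t * x (t - 1) else 0) ((i : ℕ) + 1) := by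
    ext i
    have hi : (i : ℕ) + 1 ≤ n := by omega
    simp only [mulVec, dotProduct, diffMatrix_mulVec hx, hi, if_true, Nat.add_sub_cancel]
  rw [arMatrix, smul_mulVec, Pi.smul_apply, ← mulVec_mulVec, h1, smul_eq_mul, mulVec, dotProduct]
  simp only [transpose_apply]
  rw [diffMatrix_transpose_mulVec
    (w := fun t => if t ≤ n then x t - r t * x (t - 1) else 0) (by simp), if_pos (by omega)]
  congr 2
  by_cases h : (i : ℕ) + 1 < n
  · rw [if_pos (by omega), if_pos h]; rfl
  · rw [if_neg (by omega), if_neg h, mul_zero]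

theorem arMatrix_quadForm (y : Fin n → ℝ) :
    y ⬝ᵥ (arMatrix v r n *ᵥ y) =
      v⁻¹ * ∑ t ∈ Finset.range n,
        (extendZero y (t + 1) - r (t + 1) * extendZero y t) ^ 2 := by
  have h1 : diffMatrix r n *ᵥ y = fun i : Fin n =>
      extendZero y (i + 1) - r (i + 1) * extendZero y i := by
    ext i
    rw [← diffMatrix_mulVec (extendZero_zero y)]
    simp only [extendZero_succ]
    rfl
  rw [arMatrix, smul_mulVec, dotProduct_smul, ← mulVec_mulVec, dotProduct_mulVec, vecMul_transpose,
    h1, dotProduct, smul_eq_mul,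
    ← Fin.sum_univ_eq_sum_range
      (fun t => (extendZero y (t + 1) - r (t + 1) * extendZero y t) ^ 2)]
  simp only [sq]

theorem dotProduct_self_eq_sum_extendZero (y : Fin n → ℝ) :
    y ⬝ᵥ y = ∑ t ∈ Finset.range n, extendZero y (t + 1) ^ 2 := by
  rw [← Fin.sum_univ_eq_sum_range (fun t => extendZero y (t + 1) ^ 2), dotProduct]
  simp only [extendZero_succ, sq]

theorem sum_sq_le_sum_sq_succ (x : ℕ → ℝ) (hx : x 0 = 0) (n : ℕ) :
    ∑ t ∈ Finset.range n, x t ^ 2 ≤ ∑ t ∈ Finset.range n, x (t + 1) ^ 2 := by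
  have h := Finset.sum_range_succ (fun t => x t ^ 2) n
  rw [Finset.sum_range_succ'] at h
  have h0 : x 0 ^ 2 = 0 := by simp [hx]
  nlinarith [sq_nonneg (x n)]

theorem arMatrix_quadForm_nonneg (hv : 0 < v) (y : Fin n → ℝ) :
    0 ≤ y ⬝ᵥ (arMatrix v r n *ᵥ y) := by
  rw [arMatrix_quadForm]
  positivity

theorem arMatrix_quadForm_le (hv : 0 < v) {R : ℝ} (hR : ∀ t, |r t| ≤ R) (y : Fin n → ℝ) :
    y ⬝ᵥ (arMatrix v r n *ᵥ y) ≤ v⁻¹ * (2 + 2 * R ^ 2) * (y ⬝ᵥ y) := by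
  rw [arMatrix_quadForm, dotProduct_self_eq_sum_extendZero, mul_assoc]
  refine mul_le_mul_of_nonneg_left ?_ (inv_nonneg.mpr hv.le)
  have h := sum_sq_le_sum_sq_succ _ (extendZero_zero y) n
  calc _ ≤ ∑ t ∈ Finset.range n,
        (2 * extendZero y (t + 1) ^ 2 + 2 * R ^ 2 * extendZero y t ^ 2) := by
        refine Finset.sum_le_sum fun t _ => ?_
        have h1 : r (t + 1) ^ 2 ≤ R ^ 2 := by
          rw [← sq_abs]; exact pow_le_pow_left₀ (abs_nonneg _) (hR _) 2
        nlinarith [sq_nonneg (extendZero y (t + 1) + r (t + 1) * extendZero y t),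
          mul_le_mul_of_nonneg_right h1 (sq_nonneg (extendZero y t))]
    _ ≤ _ := by
        rw [Finset.sum_add_distrib, ← Finset.mul_sum, ← Finset.mul_sum]
        nlinarith [mul_le_mul_of_nonneg_left h (sq_nonneg R)]

/-- Termwise, `(a - ρ b)² ≥ (1 - |ρ|) a² - |ρ| (1 - |ρ|) b²`, and the sum of the `b²` is at most
that of the `a²`. The hypothesis `hy` allows any coefficient at a time whose predecessor carries the
value zero. -/
theorem le_arMatrix_quadForm (hv : 0 < v) {ρ : ℝ} (hρ : |ρ| < 1) (y : Fin n → ℝ)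
    (hy : ∀ t < n, r (t + 1) * extendZero y t = ρ * extendZero y t) :
    v⁻¹ * (1 - |ρ|) ^ 2 * (y ⬝ᵥ y) ≤ y ⬝ᵥ (arMatrix v r n *ᵥ y) := by
  rw [arMatrix_quadForm, dotProduct_self_eq_sum_extendZero, mul_assoc]
  refine mul_le_mul_of_nonneg_left ?_ (inv_nonneg.mpr hv.le)
  have h := sum_sq_le_sum_sq_succ _ (extendZero_zero y) n
  calc _ ≤ ∑ t ∈ Finset.range n, ((1 - |ρ|) * extendZero y (t + 1) ^ 2 -
        |ρ| * (1 - |ρ|) * extendZero y t ^ 2) := by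
        rw [Finset.sum_sub_distrib, ← Finset.mul_sum, ← Finset.mul_sum]
        nlinarith [mul_le_mul_of_nonneg_left h
          (mul_nonneg (abs_nonneg ρ) (sub_nonneg.mpr hρ.le))]
    _ ≤ _ := by
        refine Finset.sum_le_sum fun t ht => ?_
        rw [hy t (Finset.mem_range.mp ht)]
        set a := extendZero y (t + 1)
        set b := extendZero y t
        have h1 : ρ * (a * b) ≤ |ρ| * (|a| * |b|) := by
          rw [← abs_mul, ← abs_mul]; exact le_abs_self _
        have h2 : |ρ| ^ 2 = ρ ^ 2 := sq_abs ρ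
        have h3 : |a| ^ 2 = a ^ 2 := sq_abs a
        have h4 : |b| ^ 2 = b ^ 2 := sq_abs b
        nlinarith [mul_nonneg (abs_nonneg ρ) (sq_nonneg (|a| - |b|))]

end Form

/-! ### Coefficients at and away from the breaks. -/

section Coeff

variable {ρ : ℝ} {m : ℕ} {ε : Fin m → ℝ} {k : Fin m → ℕ}

theorem scmCoeff_one (ρ : ℝ) (ε : Fin m → ℝ) (k : Fin m → ℕ) (t : ℕ) :
    scmCoeff ρ ε k (fun _ => 1) t = ρ + ∑ j, if t = k j then ε j else 0 := by
  simp only [scmCoeff, Set.indicator_apply, Set.mem_Ico]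
  congr 1
  refine Finset.sum_congr rfl fun j _ => ?_
  congr 1
  exact propext ⟨fun h => by omega, fun h => by omega⟩

theorem scmCoeff_of_ne {t : ℕ} (h : ∀ j, t ≠ k j) : scmCoeff ρ ε k (fun _ => 1) t = ρ := by
  simp [scmCoeff_one, h]

theorem scmCoeff_break (hk : Function.Injective k) (j : Fin m) :
    scmCoeff ρ ε k (fun _ => 1) (k j) = ρ + ε j := by
  simp [scmCoeff_one, hk.eq_iff]

theorem abs_scmCoeff_le (ρ : ℝ) (ε : Fin m → ℝ) (k : Fin m → ℕ) (t : ℕ) :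
    |scmCoeff ρ ε k (fun _ => 1) t| ≤ |ρ| + ∑ j, |ε j| := by
  rw [scmCoeff_one]
  refine (abs_add_le _ _).trans (add_le_add_right ((Finset.abs_sum_le_sum_abs _ _).trans ?_) _)
  refine Finset.sum_le_sum fun j _ => ?_
  split_ifs <;> simp

theorem WellSpaced.eventually_separated {k : ℕ → Fin m → ℕ} (hk : WellSpaced k (fun _ => 1))
    (D : ℕ) : ∀ᶠ n in atTop, (∀ j, D ≤ k n j) ∧ (∀ j, k n j + D ≤ n) ∧
      (∀ i j, i ≠ j → k n i + D < k n j ∨ k n j + D < k n i) := by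
  filter_upwards [hk D] with n hn
  obtain ⟨h1, h2, h3⟩ := hn
  refine ⟨h1, fun j => by have := h3 j; omega, fun i j hij => ?_⟩
  rcases lt_or_gt_of_ne hij with h | h
  · have := h2 i j h; left; omega
  · have := h2 j i h; right; omega

end Coeff

/-! ### Truncated bound states as approximate eigenvectors. -/

section TestVector

open Matrix

/-- The geometric sequence `u ^ s`, cut off after `s = D`. -/
noncomputable def cutPow (u : ℝ) (D s : ℕ) : ℝ := if s ≤ D then u ^ s else 0

/-- The bound state at a break `t₀`: geometric decay on both sides, cut off at distance `D`. -/
noncomputable def boundState (a b u : ℝ) (D t₀ t : ℕ) : ℝ :=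
  if t < t₀ then a * cutPow u D (t₀ - 1 - t) else b * cutPow u D (t - t₀)

variable {ρ w u : ℝ} {D : ℕ}

theorem boundState_right (a b u : ℝ) (D t₀ s : ℕ) :
    boundState a b u D t₀ (t₀ + s) = b * cutPow u D s := by
  simp [boundState]

theorem boundState_left (a b u : ℝ) (D s t : ℕ) :
    boundState a b u D (t + s + 1) t = a * cutPow u D s := by
  rw [boundState, if_pos (by omega)]
  congr 2
  omega

theorem boundState_eq_zero {a b u : ℝ} {t₀ t : ℕ} (h : t + 1 + D < t₀ ∨ t₀ + D < t) :
    boundState a b u D t₀ t = 0 := by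
  unfold boundState cutPow
  rcases h with h | h
  · rw [if_pos (by omega), if_neg (by omega), mul_zero]
  · rw [if_neg (by omega), if_neg (by omega), mul_zero]

/-- Since `w u = ρ`, the uncut sequence `u ^ s` solves the recurrence exactly; only the two
positions next to the cut contribute an error. -/
theorem abs_cutPow_residual_le (hw : w * u = ρ) (hu : |u| ≤ 1) (s : ℕ) :
    |(w + ρ * u) * cutPow u D (s + 1) - ρ * cutPow u D s - ρ * cutPow u D (s + 2)| ≤
      |ρ| * |u| ^ D := by
  unfold cutPow
  rcases lt_trichotomy (s + 1) D with h | h | h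
  · rw [if_pos (by omega), if_pos (by omega), if_pos (by omega)]
    rw [show (w + ρ * u) * u ^ (s + 1) - ρ * u ^ s - ρ * u ^ (s + 2) = (w * u - ρ) * u ^ s by ring,
      hw]
    simp; positivity
  · rw [if_pos (by omega), if_pos (by omega), if_neg (by omega)]
    rw [show (w + ρ * u) * u ^ (s + 1) - ρ * u ^ s - ρ * 0 =
      (w * u - ρ) * u ^ s + ρ * u * u ^ (s + 1) by ring, hw, h, sub_self, zero_mul, zero_add,
      abs_mul, abs_mul, abs_pow]
    nlinarith [mul_nonneg (abs_nonneg ρ) (pow_nonneg (abs_nonneg u) D)]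
  · rw [if_neg (show ¬ s + 1 ≤ D by omega), if_neg (show ¬ s + 2 ≤ D by omega)]
    split_ifs with h'
    · have : s = D := by omega
      subst this
      simp [abs_mul]
    · simp; positivity

theorem cutPow_one (hD : 1 ≤ D) : cutPow u D 1 = u := by simp [cutPow, hD]

theorem cutPow_zero : cutPow u D 0 = 1 := by simp [cutPow]

/-- At a break `t₀` of size `b`, the bound state nearly solves the eigenvalue equation for
`1 + ρ ^ 2 - w - ρ * u`. -/
theorem abs_boundState_residual_le {r : ℕ → ℝ} {b : ℝ} {t₀ t : ℕ} (hw0 : 0 < w) (hw : w * u = ρ)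
    (hu : |u| ≤ 1) (hb : w ^ 2 + (b ^ 2 - ρ ^ 2) * w = b ^ 2) (hD : 1 ≤ D)
    (hr0 : r t₀ = b) (hr : ∀ s, s ≠ t₀ → t₀ ≤ s + D + 2 → s ≤ t₀ + D + 2 → r s = ρ)
    (ht : 1 ≤ t) :
    |boundState w b u D t₀ t - r t * boundState w b u D t₀ (t - 1) -
        r (t + 1) * (boundState w b u D t₀ (t + 1) - r (t + 1) * boundState w b u D t₀ t) -
        (1 + ρ ^ 2 - w - ρ * u) * boundState w b u D t₀ t| ≤
      if t₀ ≤ t + D + 2 ∧ t ≤ t₀ + D + 1 then (w + |b|) * (|ρ| * |u| ^ D) else 0 := by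
  obtain ⟨t, rfl⟩ : ∃ t', t = t' + 1 := ⟨t - 1, by omega⟩
  simp only [Nat.add_sub_cancel]
  have hpos : 0 ≤ |ρ| * |u| ^ D := by positivity
  split_ifs with hwin
  · rcases lt_trichotomy (t + 1 + 1) t₀ with h | h | h
    · obtain ⟨s, rfl⟩ : ∃ s, t₀ = t + s + 3 := ⟨t₀ - t - 3, by omega⟩
      rw [hr (t + 1) (by omega) (by omega) (by omega),
        hr (t + 1 + 1) (by omega) (by omega) (by omega)]
      rw [show boundState w b u D (t + s + 3) (t + 1) = w * cutPow u D (s + 1) by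
        rw [← boundState_left w b u D (s + 1) (t + 1)]; congr 1; ring,
        show boundState w b u D (t + s + 3) t = w * cutPow u D (s + 2) by
        rw [← boundState_left w b u D (s + 2) t]; congr 1,
        show boundState w b u D (t + s + 3) (t + 1 + 1) = w * cutPow u D s by
        rw [← boundState_left w b u D s (t + 1 + 1)]; congr 1; ring]
      have := abs_cutPow_residual_le (D := D) hw hu s
      rw [show ∀ x y z : ℝ, w * x - ρ * (w * y) - ρ * (w * z - ρ * (w * x)) -
        (1 + ρ ^ 2 - w - ρ * u) * (w * x) = w * ((w + ρ * u) * x - ρ * z - ρ * y) by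
          intros; ring, abs_mul, abs_of_pos hw0]
      nlinarith [mul_le_mul_of_nonneg_left this hw0.le, mul_nonneg (abs_nonneg b) hpos]
    -- The site just before the break: this equation is the quadratic `hb` for `w`.
    · subst h
      rw [hr (t + 1) (by omega) (by omega) (by omega), hr0]
      rw [show boundState w b u D (t + 1 + 1) (t + 1) = w * cutPow u D 0 by
        rw [← boundState_left w b u D 0 (t + 1)],
        show boundState w b u D (t + 1 + 1) t = w * cutPow u D 1 by
        rw [← boundState_left w b u D 1 t],
        show boundState w b u D (t + 1 + 1) (t + 1 + 1) = b * cutPow u D 0 by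
        rw [← boundState_right w b u D (t + 1 + 1) 0], cutPow_one hD, cutPow_zero]
      rw [show w * 1 - ρ * (w * u) - b * (b * 1 - b * (w * 1)) -
        (1 + ρ ^ 2 - w - ρ * u) * (w * 1) = w ^ 2 + (b ^ 2 - ρ ^ 2) * w - b ^ 2 by ring, hb]
      simp; positivity
    · obtain ⟨s, hs⟩ : ∃ s, t + 1 = t₀ + s := ⟨t + 1 - t₀, by omega⟩
      rw [hs, hr (t₀ + s + 1) (by omega) (by omega) (by omega), add_assoc t₀ s 1,
        boundState_right, boundState_right]
      -- At the break itself the amplitudes `w` (left) and `b` (right) solve the equation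
      -- identically.
      rcases s with _ | s
      · have ht0 : t₀ = t + 1 := by omega
        rw [add_zero, hr0, cutPow_one hD, cutPow_zero]
        rw [show boundState w b u D t₀ t = w * cutPow u D 0 by
          rw [ht0, ← boundState_left w b u D 0 t], cutPow_zero]
        rw [show b * 1 - b * (w * 1) - ρ * (b * u - ρ * (b * 1)) -
          (1 + ρ ^ 2 - w - ρ * u) * (b * 1) = 0 by ring]
        simp; positivity
      · have ht : t = t₀ + s := by omega
        rw [hr (t₀ + (s + 1)) (by omega) (by omega) (by omega), ht, boundState_right]
        have := abs_cutPow_residual_le (D := D) hw hu s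
        rw [show ∀ x y z : ℝ, b * x - ρ * (b * y) - ρ * (b * z - ρ * (b * x)) -
          (1 + ρ ^ 2 - w - ρ * u) * (b * x) = b * ((w + ρ * u) * x - ρ * y - ρ * z) by
            intros; ring, abs_mul]
        nlinarith [mul_le_mul_of_nonneg_left this (abs_nonneg b), mul_nonneg hw0.le hpos]
  · have h' : t + 1 + D + 2 < t₀ ∨ t₀ + D + 1 < t + 1 := by omega
    rw [boundState_eq_zero (t := t + 1) (by omega), boundState_eq_zero (t := t) (by omega),
      boundState_eq_zero (t := t + 1 + 1) (by omega)]
    simp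

/-- Orthogonality of the `φ j` is replaced by their values at the sites, which bound the norm of a
combination below by `b² ∑ a j²`; Cauchy–Schwarz bounds its residual at the cost of a factor
`Fintype.card ι`. -/
theorem card_le_eigenvalueCount_of_sites {n : ℕ} {A : Matrix (Fin n) (Fin n) ℝ} {ι : Type*}
    [Fintype ι] [DecidableEq ι] (hA : A.IsHermitian) {x δ b η : ℝ} (hδ : 0 ≤ δ)
    (φ : ι → Fin n → ℝ) {s : ι → Fin n} (hs : Function.Injective s)
    (hφ : ∀ i j, φ i (s j) = if i = j then b else 0)
    (hres : ∀ j, (A *ᵥ φ j - x • φ j) ⬝ᵥ (A *ᵥ φ j - x • φ j) ≤ η)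
    (hη : Fintype.card ι * η < δ ^ 2 * b ^ 2) :
    Fintype.card ι ≤ eigenvalueCount A x δ := by
  refine card_le_eigenvalueCount hA hδ φ fun a ha => ?_
  have hpos : 0 < ∑ j, a j ^ 2 := by
    obtain ⟨j, hj⟩ := Function.ne_iff.mp ha
    exact Finset.sum_pos' (fun i _ => sq_nonneg _) ⟨j, Finset.mem_univ _, sq_pos_of_ne_zero hj⟩
  have h1 : A *ᵥ (∑ j, a j • φ j) - x • ∑ j, a j • φ j = ∑ j, a j • (A *ᵥ φ j - x • φ j) := by
    rw [mulVec_sum, Finset.smul_sum, ← Finset.sum_sub_distrib]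
    refine Finset.sum_congr rfl fun j _ => ?_
    rw [mulVec_smul, smul_sub, smul_comm]
  have h2 : (∑ j, a j • (A *ᵥ φ j - x • φ j)) ⬝ᵥ (∑ j, a j • (A *ᵥ φ j - x • φ j)) ≤
      Fintype.card ι * η * ∑ j, a j ^ 2 := by
    calc _ = ∑ t, (∑ j, a j * (A *ᵥ φ j - x • φ j) t) ^ 2 := by
          rw [dotProduct]
          refine Finset.sum_congr rfl fun t _ => ?_
          simp [sq]
      _ ≤ ∑ t, (Fintype.card ι : ℝ) * ∑ j, (a j * (A *ᵥ φ j - x • φ j) t) ^ 2 :=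
          Finset.sum_le_sum fun t _ => by
            simpa using sq_sum_le_card_mul_sum_sq (s := Finset.univ)
              (f := fun j => a j * (A *ᵥ φ j - x • φ j) t)
      _ = Fintype.card ι * ∑ j, a j ^ 2 * ((A *ᵥ φ j - x • φ j) ⬝ᵥ (A *ᵥ φ j - x • φ j)) := by
          rw [← Finset.mul_sum, Finset.sum_comm]
          congr 1
          refine Finset.sum_congr rfl fun j _ => ?_
          rw [dotProduct, Finset.mul_sum]
          exact Finset.sum_congr rfl fun t _ => by ring
      _ ≤ Fintype.card ι * ∑ j, a j ^ 2 * η := by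
          gcongr with j _
          exact hres j
      _ = _ := by rw [← Finset.sum_mul]; ring
  have h3 : b ^ 2 * ∑ j, a j ^ 2 ≤ (∑ j, a j • φ j) ⬝ᵥ (∑ j, a j • φ j) := by
    calc b ^ 2 * ∑ j, a j ^ 2 = ∑ j, ((∑ i, a i • φ i) (s j)) ^ 2 := by
          rw [Finset.mul_sum]
          refine Finset.sum_congr rfl fun j _ => ?_
          simp [hφ]
          ring
      _ = ∑ t ∈ Finset.univ.map ⟨s, hs⟩, ((∑ i, a i • φ i) t) ^ 2 := by
          rw [Finset.sum_map]; rfl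
      _ ≤ ∑ t, ((∑ i, a i • φ i) t) ^ 2 :=
          Finset.sum_le_univ_sum_of_nonneg fun t => sq_nonneg _
      _ = _ := by simp only [dotProduct, sq]
  rw [h1]
  calc _ ≤ Fintype.card ι * η * ∑ j, a j ^ 2 := h2
    _ < δ ^ 2 * b ^ 2 * ∑ j, a j ^ 2 := by gcongr
    _ ≤ _ := by rw [mul_assoc]; gcongr

end TestVector

/-! ### The outlier as an injective function of the magnitude. -/

section OutlierValue

/-- The inverse decay rate (times `ρ`) of the bound state of low energy at a break of
magnitude `e`. -/
noncomputable def decayRoot (ρ e : ℝ) : ℝ :=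
  (-((ρ + e) ^ 2 - ρ ^ 2) + √(((ρ + e) ^ 2 - ρ ^ 2) ^ 2 + 4 * (ρ + e) ^ 2)) / 2

/-- The outlier below the bulk produced by a break of magnitude `e`. -/
noncomputable def lowOutlier (v ρ e : ℝ) : ℝ :=
  v⁻¹ * (1 + ρ ^ 2 - decayRoot ρ e - ρ * (ρ / decayRoot ρ e))

variable {v ρ e : ℝ}

theorem sq_lt_sq_add_of_mem_magnitudes (hρ0 : ρ ≠ 0) (he : e ∈ magnitudes ρ) :
    0 < (ρ + e) ^ 2 - ρ ^ 2 := by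
  unfold magnitudes at he
  split_ifs at he with h
  · have := Set.mem_Ioi.mp he
    nlinarith
  · have := Set.mem_Iio.mp he
    have h' : ρ < 0 := lt_of_le_of_ne (not_lt.mp h) hρ0
    nlinarith

theorem decayRoot_sq (ρ e : ℝ) :
    decayRoot ρ e ^ 2 + ((ρ + e) ^ 2 - ρ ^ 2) * decayRoot ρ e = (ρ + e) ^ 2 := by
  have := Real.sq_sqrt (show 0 ≤ ((ρ + e) ^ 2 - ρ ^ 2) ^ 2 + 4 * (ρ + e) ^ 2 by positivity)
  unfold decayRoot
  linear_combination this / 4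

/-- At `1` the quadratic defining the root takes the value `1 - ρ² > 0`. -/
theorem decayRoot_lt_one (hρ : |ρ| < 1) (hρ0 : ρ ≠ 0) (he : e ∈ magnitudes ρ) :
    decayRoot ρ e < 1 := by
  have hd := sq_lt_sq_add_of_mem_magnitudes hρ0 he
  have h2 : ρ ^ 2 < 1 := (sq_lt_one_iff_abs_lt_one ρ).mpr hρ
  have : √(((ρ + e) ^ 2 - ρ ^ 2) ^ 2 + 4 * (ρ + e) ^ 2) < 2 + ((ρ + e) ^ 2 - ρ ^ 2) := by
    rw [Real.sqrt_lt' (by linarith)]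
    nlinarith
  unfold decayRoot
  linarith

/-- At `|ρ|` the quadratic equals `((ρ + e)² - ρ²)(|ρ| - 1) < 0`. The bound makes the state decay.
-/
theorem abs_lt_decayRoot (hρ : |ρ| < 1) (hρ0 : ρ ≠ 0) (he : e ∈ magnitudes ρ) :
    |ρ| < decayRoot ρ e := by
  have hd := sq_lt_sq_add_of_mem_magnitudes hρ0 he
  have h2 : |ρ| ^ 2 = ρ ^ 2 := sq_abs ρ
  have : ((ρ + e) ^ 2 - ρ ^ 2) + 2 * |ρ| <
      √(((ρ + e) ^ 2 - ρ ^ 2) ^ 2 + 4 * (ρ + e) ^ 2) := by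
    apply Real.lt_sqrt_of_sq_lt
    nlinarith [mul_pos hd (sub_pos.mpr hρ)]
  unfold decayRoot
  linarith

/-- The gap to the bulk is `v⁻¹ (w - |ρ|)² / w` with `w = decayRoot ρ e`. -/
theorem lowOutlier_lt (hv : 0 < v) (hρ : |ρ| < 1) (hρ0 : ρ ≠ 0) (he : e ∈ magnitudes ρ) :
    lowOutlier v ρ e < v⁻¹ * (1 - |ρ|) ^ 2 := by
  have hw := abs_lt_decayRoot hρ hρ0 he
  unfold lowOutlier
  set w := decayRoot ρ e
  have hw0 : 0 < w := (abs_nonneg ρ).trans_lt hw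
  refine mul_lt_mul_of_pos_left ?_ (inv_pos.mpr hv)
  have h2 : |ρ| ^ 2 = ρ ^ 2 := sq_abs ρ
  have h3 : w + ρ * (ρ / w) - 2 * |ρ| = (w - |ρ|) ^ 2 / w := by
    field_simp
    linear_combination -h2
  have h4 : 0 < (w - |ρ|) ^ 2 / w := div_pos (pow_pos (sub_pos.mpr hw) 2) hw0
  nlinarith

/-- The function `w + ρ² / w` is injective on `w > |ρ|`, so the energy fixes `w`; as `w ≠ 1`, the
quadratic then fixes `(ρ + e)²`, and the sign of `e` selects the root. -/
theorem lowOutlier_injOn (hv : 0 < v) (hρ : |ρ| < 1) (hρ0 : ρ ≠ 0) :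
    Set.InjOn (lowOutlier v ρ) (magnitudes ρ) := by
  intro e he e' he' h
  have hw := abs_lt_decayRoot hρ hρ0 he
  have hw' := abs_lt_decayRoot hρ hρ0 he'
  have hw1 := decayRoot_lt_one hρ hρ0 he
  have hq := decayRoot_sq ρ e
  have hq' := decayRoot_sq ρ e'
  unfold lowOutlier at h
  set w := decayRoot ρ e
  set w' := decayRoot ρ e'
  have hw0 : 0 < w := (abs_nonneg ρ).trans_lt hw
  have hw0' : 0 < w' := (abs_nonneg ρ).trans_lt hw'
  have h1 := mul_left_cancel₀ (inv_ne_zero hv.ne') h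
  have h2 : (w - w') * (w * w' - ρ ^ 2) = 0 := by
    field_simp at h1
    linear_combination -h1
  have h3 : w = w' := by
    rcases mul_eq_zero.mp h2 with h3 | h3
    · linarith
    · exfalso
      have : |ρ| * |ρ| < w * w' := mul_lt_mul'' hw hw' (abs_nonneg _) (abs_nonneg _)
      rw [abs_mul_abs_self] at this
      nlinarith
  rw [← h3] at hq'
  have h4 : ((ρ + e) ^ 2 - (ρ + e') ^ 2) * (w - 1) = 0 := by linear_combination hq - hq'
  have h5 : (e - e') * (2 * ρ + e + e') = 0 := by
    rcases mul_eq_zero.mp h4 with h5 | h5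
    · linear_combination h5
    · linarith
  rcases mul_eq_zero.mp h5 with h6 | h6
  · linarith
  · exfalso
    unfold magnitudes at he he'
    split_ifs at he he' with hpos
    · have := Set.mem_Ioi.mp he
      have := Set.mem_Ioi.mp he'
      linarith
    · have := Set.mem_Iio.mp he
      have := Set.mem_Iio.mp he'
      linarith

end OutlierValue

/-! ### Exact multiplicity of the low outliers. -/

section Counts

open Matrix

variable {v ρ : ℝ} {m : ℕ} {ε : Fin m → ℝ} {k : ℕ → Fin m → ℕ}

theorem card_window_le (n D t₀ : ℕ) :
    (Finset.univ.filter fun i : Fin n => t₀ ≤ i + 1 + D + 2 ∧ (i : ℕ) + 1 ≤ t₀ + D + 1).card ≤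
      2 * D + 4 := by
  calc _ ≤ (Finset.Icc (t₀ - D - 3) (t₀ + D)).card := by
        refine Finset.card_le_card_of_injOn (fun i => (i : ℕ)) (fun i hi => ?_)
          Fin.val_injective.injOn
        simp only [Finset.coe_filter, Finset.mem_univ, true_and, Set.mem_ofPred_eq] at hi
        simp only [Finset.coe_Icc, Set.mem_Icc]
        omega
    _ ≤ _ := by rw [Nat.card_Icc]; omega

theorem tendsto_residual_bound {u : ℝ} (hu : |u| < 1) (c K : ℝ) :
    Tendsto (fun D : ℕ => c * ((2 * D + 4) * (K * |u| ^ D) ^ 2)) atTop (𝓝 0) := by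
  have hu2 : |(|u| ^ 2)| < 1 := by
    rw [abs_pow, abs_abs]
    exact pow_lt_one₀ (abs_nonneg u) hu two_ne_zero
  have h1 := tendsto_pow_const_mul_const_pow_of_abs_lt_one 1 hu2
  have h0 := tendsto_pow_const_mul_const_pow_of_abs_lt_one 0 hu2
  have := (h1.const_mul (c * 2 * K ^ 2)).add (h0.const_mul (c * 4 * K ^ 2))
  simp only [mul_zero, add_zero] at this
  refine this.congr fun D => ?_
  ring

/-- Each break of magnitude `e` carries a copy of the bound state. The residual is a linearly
growing window times a geometrically small error, so the cutoff `D` can be fixed before `n`; for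
large `n` no copy meets another break or an end. -/
theorem eventually_card_le_eigenvalueCount (hv : 0 < v) (hρ : |ρ| < 1) (hρ0 : ρ ≠ 0)
    (hk : WellSpaced k (fun _ => 1)) {e : ℝ} (he : e ∈ magnitudes ρ) {δ : ℝ} (hδ : 0 < δ) :
    ∀ᶠ n in atTop, Fintype.card {j // ε j = e} ≤
      eigenvalueCount (arMatrix v (scmCoeff ρ ε (k n) (fun _ => 1)) n) (lowOutlier v ρ e) δ := by
  have hw := abs_lt_decayRoot hρ hρ0 he
  have hq := decayRoot_sq ρ e
  have hbρ := sq_lt_sq_add_of_mem_magnitudes hρ0 he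
  unfold lowOutlier
  set w := decayRoot ρ e
  set b := ρ + e
  have hw0 : 0 < w := (abs_nonneg ρ).trans_lt hw
  set u := ρ / w
  have hwu : w * u = ρ := mul_div_cancel₀ ρ hw0.ne'
  have hu : |u| < 1 := by rw [abs_div, abs_of_pos hw0, div_lt_one hw0]; exact hw
  set K := v⁻¹ * ((w + |b|) * |ρ|)
  obtain ⟨D, hDη, hD⟩ : ∃ D : ℕ, (Fintype.card {j // ε j = e} : ℝ) *
      ((2 * D + 4) * (K * |u| ^ D) ^ 2) < δ ^ 2 * b ^ 2 ∧ 1 ≤ D := by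
    have hpos : 0 < δ ^ 2 * b ^ 2 := mul_pos (pow_pos hδ 2) (by nlinarith [sq_nonneg ρ])
    exact (((tendsto_residual_bound hu _ K).eventually (gt_mem_nhds hpos)).and
      (eventually_ge_atTop 1)).exists
  filter_upwards [hk.eventually_separated (2 * D + 6)] with n hn
  obtain ⟨hn1, hn2, hn3⟩ := hn
  have hinj : Function.Injective (k n) := fun i j hij => by
    by_contra hne
    have := hn3 i j hne
    omega
  set r := scmCoeff ρ ε (k n) (fun _ => 1)
  refine card_le_eigenvalueCount_of_sites (arMatrix_isHermitian v r n) hδ.le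
    (fun (j : {j // ε j = e}) (i : Fin n) => boundState w b u D (k n j) (i + 1))
    -- Index `k n j - 1` is time `k n j`, where the bound state equals `b`.
    (s := fun j => ⟨k n j - 1, by have := hn1 j; have := hn2 j; omega⟩) ?_ ?_ ?_ hDη
  · intro i j hij
    have h1 : k n i - 1 = k n j - 1 := congrArg Fin.val hij
    have := hn1 i
    have := hn1 j
    exact Subtype.ext (hinj (by omega))
  · intro i j
    have := hn1 j
    rw [show k n j - 1 + 1 = k n j by omega]
    split_ifs with hij
    · subst hij
      simpa [cutPow_zero] using boundState_right w b u D (k n i) 0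
    · refine boundState_eq_zero ?_
      have := hn3 i j (fun h => hij (Subtype.ext h))
      omega
  · rintro ⟨j, hj⟩
    set t₀ := k n j
    have ht₀ := hn1 j
    have ht₀' := hn2 j
    have hr0 : r t₀ = b := by
      have := scmCoeff_break (ρ := ρ) (ε := ε) hinj j
      rwa [hj] at this
    have hr : ∀ s, s ≠ t₀ → t₀ ≤ s + D + 2 → s ≤ t₀ + D + 2 → r s = ρ := by
      intro s hs h1 h2
      refine scmCoeff_of_ne fun i hi => ?_
      by_cases hij : i = j
      · exact hs (hi.trans (by rw [hij]))
      · have := hn3 i j hij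
        omega
    have hbound : ∀ i : Fin n, ((arMatrix v r n *ᵥ fun i : Fin n => boundState w b u D t₀ (i + 1)) -
        (v⁻¹ * (1 + ρ ^ 2 - w - ρ * u)) • fun i : Fin n => boundState w b u D t₀ (i + 1)) i ^ 2 ≤
        if t₀ ≤ i + 1 + D + 2 ∧ (i : ℕ) + 1 ≤ t₀ + D + 1 then (K * |u| ^ D) ^ 2 else 0 := by
      intro i
      have hz : boundState w b u D t₀ 0 = 0 := boundState_eq_zero (by omega)
      have h1 := abs_boundState_residual_le (t := i + 1) hw0 hwu hu.le hq hD hr0 hr (by omega)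
      rw [Nat.add_sub_cancel] at h1
      have h2 : ((arMatrix v r n *ᵥ fun i : Fin n => boundState w b u D t₀ (i + 1)) -
        (v⁻¹ * (1 + ρ ^ 2 - w - ρ * u)) • fun i : Fin n => boundState w b u D t₀ (i + 1)) i =
          v⁻¹ * (boundState w b u D t₀ (i + 1) - r (i + 1) * boundState w b u D t₀ i -
            r (i + 1 + 1) * (boundState w b u D t₀ (i + 1 + 1) -
              r (i + 1 + 1) * boundState w b u D t₀ (i + 1)) -
            (1 + ρ ^ 2 - w - ρ * u) * boundState w b u D t₀ (i + 1)) := by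
        rw [Pi.sub_apply, Pi.smul_apply, arMatrix_mulVec_apply hz, smul_eq_mul]
        by_cases hi : (i : ℕ) + 1 < n
        · rw [if_pos hi]
          ring
        · rw [if_neg hi, boundState_eq_zero (t := i + 1) (by omega),
            boundState_eq_zero (t := i + 1 + 1) (by omega)]
          ring
      rw [h2, ← sq_abs, abs_mul, abs_of_pos (inv_pos.mpr hv)]
      split_ifs at h1 ⊢ with hwin
      · refine pow_le_pow_left₀ (by positivity) ?_ 2
        calc _ ≤ v⁻¹ * ((w + |b|) * (|ρ| * |u| ^ D)) :=
              mul_le_mul_of_nonneg_left h1 (inv_nonneg.mpr hv.le)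
          _ = _ := by ring
      · rw [le_antisymm h1 (abs_nonneg _)]
        simp
    rw [dotProduct]
    simp only [← sq]
    calc _ ≤ ∑ i : Fin n, if t₀ ≤ i + 1 + D + 2 ∧ (i : ℕ) + 1 ≤ t₀ + D + 1 then
          (K * |u| ^ D) ^ 2 else 0 := Finset.sum_le_sum fun i _ => hbound i
      _ ≤ _ := by
          rw [← Finset.sum_filter, Finset.sum_const, nsmul_eq_mul]
          refine mul_le_mul_of_nonneg_right ?_ (sq_nonneg _)
          exact_mod_cast card_window_le n D t₀

theorem eventually_card_roots_lt_le (hv : 0 < v) (hρ : |ρ| < 1)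
    (hk : WellSpaced k (fun _ => 1)) :
    ∀ᶠ n in atTop, ((arMatrix v (scmCoeff ρ ε (k n) (fun _ => 1)) n).charpoly.roots.filter
      (· < v⁻¹ * (1 - |ρ|) ^ 2)).card ≤ m := by
  filter_upwards [hk.eventually_separated 2] with n hn
  obtain ⟨hn1, hn2, -⟩ := hn
  refine card_roots_lt_le (arMatrix_isHermitian _ _ n)
    -- Index `k n j - 2` is time `k n j - 1`: the changed coefficient multiplies only this value.
    (fun j => ⟨k n j - 2, by have := hn1 j; have := hn2 j; omega⟩) fun y hy => ?_
  refine le_arMatrix_quadForm hv hρ y fun t ht => ?_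
  by_cases h : ∃ j, t + 1 = k n j
  · obtain ⟨j, hj⟩ := h
    have h0 := hy j
    rw [← extendZero_succ y] at h0
    have := hn1 j
    simp only [show k n j - 2 + 1 = t by omega] at h0
    rw [h0, mul_zero, mul_zero]
  · push Not at h
    rw [scmCoeff_of_ne h]

theorem Multiset.sum_card_filter_le {α β : Type*} (R : Multiset α) (T : Finset β)
    (p : β → α → Prop) (q : α → Prop) [∀ b, DecidablePred (p b)] [DecidablePred q]
    (hp : ∀ b ∈ T, ∀ b' ∈ T, ∀ a, p b a → p b' a → b = b') (hq : ∀ b ∈ T, ∀ a, p b a → q a) :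
    ∑ b ∈ T, (R.filter (p b)).card ≤ (R.filter q).card := by
  classical
  simp only [← Multiset.countP_eq_card_filter]
  induction R using Multiset.induction_on with
  | empty => simp
  | cons a R ih =>
    simp only [Multiset.countP_cons, Finset.sum_add_distrib]
    refine add_le_add ih ?_
    rw [← Finset.card_filter]
    by_cases ha : ∃ b ∈ T, p b a
    · obtain ⟨b, hb, hba⟩ := ha
      rw [if_pos (hq b hb a hba)]
      refine Finset.card_le_one.mpr fun x hx y hy => ?_
      rw [Finset.mem_filter] at hx hy
      exact hp x hx.1 y hy.1 a hx.2 hy.2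
    · push Not at ha
      rw [Finset.filter_false_of_mem ha]
      simp

theorem exists_separating_radius {T : Finset ℝ} {f : ℝ → ℝ} (hf : Set.InjOn f T) {c : ℝ}
    (hc : ∀ e ∈ T, f e < c) :
    ∃ δ > 0, (∀ e ∈ T, f e + δ ≤ c) ∧
      ∀ e ∈ T, ∀ e' ∈ T, e ≠ e' → 2 * δ ≤ |f e - f e'| := by
  have key : ∀ x : ℝ, 0 < x → ∀ᶠ δ in 𝓝[>] (0 : ℝ), 2 * δ ≤ x := fun x hx => by
    filter_upwards [Ioo_mem_nhdsGT (half_pos hx)] with δ hδ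
    linarith [hδ.2]
  have h1 : ∀ᶠ δ in 𝓝[>] (0 : ℝ), ∀ e ∈ T, f e + δ ≤ c := by
    rw [eventually_all_finset]
    intro e he
    filter_upwards [key _ (sub_pos.mpr (hc e he)), self_mem_nhdsWithin] with δ hδ hδ0
    have : 0 < δ := hδ0
    linarith
  have h2 : ∀ᶠ δ in 𝓝[>] (0 : ℝ), ∀ e ∈ T, ∀ e' ∈ T, e ≠ e' → 2 * δ ≤ |f e - f e'| := by
    simp only [eventually_all_finset]
    intro e he e' he'
    by_cases hee : e = e'
    · simp [hee]
    · filter_upwards [key _ (abs_pos.mpr (sub_ne_zero.mpr fun h => hee (hf he he' h)))] with δ hδ _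
      exact hδ
  obtain ⟨δ, ⟨hδ1, hδ2⟩, hδ0⟩ := ((h1.and h2).and self_mem_nhdsWithin).exists
  exact ⟨δ, hδ0, hδ1, hδ2⟩

/-- Disjoint windows below the bulk hold at most `m` eigenvalues altogether, while their individual
lower bounds sum to `m`; hence each window count is exact. -/
theorem exists_eventually_eigenvalueCount_le (hv : 0 < v) (hρ : |ρ| < 1) (hρ0 : ρ ≠ 0)
    (hε : ∀ j, ε j ∈ magnitudes ρ) (hk : WellSpaced k (fun _ => 1)) {e : ℝ}
    (he : e ∈ magnitudes ρ) :
    ∃ δ > 0, ∀ᶠ n in atTop,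
      eigenvalueCount (arMatrix v (scmCoeff ρ ε (k n) (fun _ => 1)) n) (lowOutlier v ρ e) δ ≤
        Fintype.card {j // ε j = e} := by
  classical
  -- A magnitude `e` that no break has is included too, with lower bound zero.
  set T : Finset ℝ := insert e (Finset.univ.image ε) with hT
  have hTm : ∀ a ∈ T, a ∈ magnitudes ρ := by
    intro a ha
    rcases Finset.mem_insert.mp ha with rfl | ha
    · exact he
    · obtain ⟨j, -, rfl⟩ := Finset.mem_image.mp ha
      exact hε j
  obtain ⟨δ, hδ, hδ1, hδ2⟩ := exists_separating_radius (T := T) (f := lowOutlier v ρ)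
    ((lowOutlier_injOn hv hρ hρ0).mono fun a ha => hTm a ha)
    (fun a ha => lowOutlier_lt hv hρ hρ0 (hTm a ha))
  refine ⟨δ, hδ, ?_⟩
  have hlow : ∀ᶠ n in atTop, ∀ a ∈ T, Fintype.card {j // ε j = a} ≤
      eigenvalueCount (arMatrix v (scmCoeff ρ ε (k n) (fun _ => 1)) n) (lowOutlier v ρ a) δ := by
    rw [eventually_all_finset]
    exact fun a ha => eventually_card_le_eigenvalueCount hv hρ hρ0 hk (hTm a ha) hδ
  filter_upwards [hlow, eventually_card_roots_lt_le (ε := ε) hv hρ hk] with n hn1 hn2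
  have hsum : ∑ a ∈ T, Fintype.card {j // ε j = a} = m := by
    have := Finset.card_eq_sum_card_fiberwise (s := Finset.univ) (t := T) (f := ε)
      (fun j _ => by simp [hT])
    rw [Finset.card_univ, Fintype.card_fin] at this
    refine Eq.trans (Finset.sum_congr rfl fun a _ => ?_) this.symm
    exact Fintype.card_subtype _
  have hle : ∑ a ∈ T, eigenvalueCount (arMatrix v (scmCoeff ρ ε (k n) (fun _ => 1)) n)
      (lowOutlier v ρ a) δ ≤ ∑ a ∈ T, Fintype.card {j // ε j = a} := by
    rw [hsum]
    refine le_trans (Multiset.sum_card_filter_le _ T _ _ ?_ ?_) hn2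
    · intro a ha a' ha' x hx hx'
      by_contra hne
      have h1 := hδ2 a ha a' ha' hne
      rw [abs_sub_comm] at hx'
      have h2 := abs_sub_le (lowOutlier v ρ a) x (lowOutlier v ρ a')
      linarith
    · intro a ha x hx
      have h1 := hδ1 a ha
      have h2 := (abs_lt.mp hx).1
      linarith
  have heq := (Finset.sum_eq_sum_iff_of_le hn1).mp (le_antisymm (Finset.sum_le_sum hn1) hle)
  exact (heq e (Finset.mem_insert_self _ _)).ge

/-- The multiplicity of the outlier attached to a magnitude is the number of breaks of that
magnitude. -/
theorem out_arMatrix_lowOutlier (hv : 0 < v) (hρ : |ρ| < 1) (hρ0 : ρ ≠ 0)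
    (hε : ∀ j, ε j ∈ magnitudes ρ) (hk : WellSpaced k (fun _ => 1))
    (hμ : ∃ μ : Measure ℝ, IsASD (fun n => arMatrix v (scmCoeff ρ ε (k n) (fun _ => 1)) n) μ ∧
      IsCompact μ.support ∧ μ.support ⊆ Set.Ici (v⁻¹ * (1 - |ρ|) ^ 2))
    {e : ℝ} (he : e ∈ magnitudes ρ) :
    out (fun n => arMatrix v (scmCoeff ρ ε (k n) (fun _ => 1)) n) (lowOutlier v ρ e) =
      (Fintype.card {j // ε j = e} : ℕ∞) := by
  have hlow := fun δ (hδ : 0 < δ) =>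
    eventually_card_le_eigenvalueCount (ε := ε) hv hρ hρ0 hk he hδ
  unfold out
  split_ifs with hO
  · refine le_antisymm (iSup₂_le fun c hc => ?_) (le_iSup₂_of_le _ hlow le_rfl)
    obtain ⟨δ, hδ, hup⟩ := exists_eventually_eigenvalueCount_le hv hρ hρ0 hε hk he
    obtain ⟨n, h1, h2⟩ := ((hc δ hδ).and hup).exists
    exact_mod_cast h1.trans h2
  -- A non-outlier has multiplicity zero by default, so a break of magnitude `e` must be shown to
  -- make this value an outlier.
  · symm
    by_contra hne
    have hpos : 0 < Fintype.card {j // ε j = e} :=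
      Nat.pos_of_ne_zero fun h => hne (by exact_mod_cast h)
    apply hO
    obtain ⟨μ, hμ1, hμ2, hμ3⟩ := hμ
    refine ⟨⟨μ, hμ1, hμ2, fun hx => ?_⟩, ?_⟩
    · rw [hμ2.isClosed.closure_eq] at hx
      exact absurd (lowOutlier_lt hv hρ hρ0 he) (not_lt.mpr (hμ3 hx))
    · rw [Metric.tendsto_nhds]
      intro δ hδ
      filter_upwards [hlow δ hδ] with n hn
      obtain ⟨y, hy⟩ := Multiset.card_pos_iff_exists_mem.mp (hpos.trans_le hn)
      rw [Multiset.mem_filter] at hy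
      have hys : y ∈ spectrum ℝ (arMatrix v (scmCoeff ρ ε (k n) (fun _ => 1)) n) :=
        Matrix.mem_spectrum_iff_isRoot_charpoly.mpr (Polynomial.isRoot_of_mem_roots hy.1)
      rw [Real.dist_eq, sub_zero, abs_of_nonneg Metric.infDist_nonneg]
      exact (Metric.infDist_le_dist_of_mem hys).trans_lt (by rw [Real.dist_eq]; exact hy.2)

end Counts

/-! ### Fourier coefficients of powers of the symbol. -/

section Symbol

/-- The symbol `v⁻¹ |1 - ρ e^{iθ}|²` of the unperturbed precision matrices. -/
noncomputable def arSymbol (v ρ θ : ℝ) : ℝ := v⁻¹ * (1 + ρ ^ 2 - 2 * ρ * Real.cos θ)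

/-- The `j`-th Fourier cosine coefficient of the `q`-th power of the symbol. -/
noncomputable def symbolCoeff (v ρ : ℝ) (q : ℕ) (j : ℤ) : ℝ :=
  (2 * Real.pi)⁻¹ * ∫ θ in (0)..(2 * Real.pi), arSymbol v ρ θ ^ q * Real.cos (j * θ)

theorem continuous_arSymbol (v ρ : ℝ) : Continuous (arSymbol v ρ) := by
  unfold arSymbol
  fun_prop

theorem arSymbol_mem_Icc {v : ℝ} (hv : 0 < v) (ρ θ : ℝ) :
    arSymbol v ρ θ ∈ Set.Icc (v⁻¹ * (1 - |ρ|) ^ 2) (v⁻¹ * (1 + |ρ|) ^ 2) := by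
  have h : |ρ * Real.cos θ| ≤ |ρ| := by
    rw [abs_mul]
    exact mul_le_of_le_one_right (abs_nonneg _) (Real.abs_cos_le_one θ)
  have h1 := abs_le.mp h
  have h2 : |ρ| ^ 2 = ρ ^ 2 := sq_abs ρ
  exact ⟨mul_le_mul_of_nonneg_left (by nlinarith) (inv_nonneg.mpr hv.le),
    mul_le_mul_of_nonneg_left (by nlinarith) (inv_nonneg.mpr hv.le)⟩

theorem symbolCoeff_zero (v ρ : ℝ) (j : ℤ) : symbolCoeff v ρ 0 j = if j = 0 then 1 else 0 := by
  unfold symbolCoeff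
  simp only [pow_zero, one_mul]
  split_ifs with hj
  · subst hj
    simp
    field_simp
  · have hj' : (j : ℝ) ≠ 0 := Int.cast_ne_zero.mpr hj
    have : ∫ θ in (0)..(2 * Real.pi), Real.cos (j * θ) = 0 := by
      rw [intervalIntegral.integral_comp_mul_left (fun θ => Real.cos θ) hj', integral_cos,
        mul_zero, Real.sin_zero, show (j : ℝ) * (2 * Real.pi) = ((2 * j : ℤ) : ℝ) * Real.pi by
          push_cast; ring, Real.sin_int_mul_pi]
      simp
    rw [this, mul_zero]

/-- By `2 cos θ cos jθ = cos (j - 1)θ + cos (j + 1)θ`, multiplication by the symbol acts on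
coefficients as an unperturbed matrix row. -/
theorem symbolCoeff_succ (v ρ : ℝ) (q : ℕ) (j : ℤ) :
    symbolCoeff v ρ (q + 1) j = v⁻¹ * ((1 + ρ ^ 2) * symbolCoeff v ρ q j -
      ρ * symbolCoeff v ρ q (j - 1) - ρ * symbolCoeff v ρ q (j + 1)) := by
  have hc : ∀ i : ℤ, IntervalIntegrable (fun θ => arSymbol v ρ θ ^ q * Real.cos (i * θ)) volume 0
      (2 * Real.pi) := fun i => by
    have := continuous_arSymbol v ρ
    exact Continuous.intervalIntegrable (by fun_prop) _ _
  have h : ∫ θ in (0)..(2 * Real.pi), arSymbol v ρ θ ^ (q + 1) * Real.cos (j * θ) =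
      v⁻¹ * ((1 + ρ ^ 2) * (∫ θ in (0)..(2 * Real.pi), arSymbol v ρ θ ^ q * Real.cos (j * θ)) -
        ρ * (∫ θ in (0)..(2 * Real.pi), arSymbol v ρ θ ^ q * Real.cos ((j - 1 : ℤ) * θ)) -
        ρ * ∫ θ in (0)..(2 * Real.pi), arSymbol v ρ θ ^ q * Real.cos ((j + 1 : ℤ) * θ)) := by
    rw [← intervalIntegral.integral_const_mul, ← intervalIntegral.integral_const_mul,
      ← intervalIntegral.integral_const_mul,
      ← intervalIntegral.integral_sub ((hc j).const_mul _) ((hc (j - 1)).const_mul _),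
      ← intervalIntegral.integral_sub (((hc j).const_mul _).sub ((hc (j - 1)).const_mul _))
        ((hc (j + 1)).const_mul _), ← intervalIntegral.integral_const_mul]
    refine intervalIntegral.integral_congr fun θ _ => ?_
    have e1 : Real.cos ((j - 1 : ℤ) * θ) =
        Real.cos (j * θ) * Real.cos θ + Real.sin (j * θ) * Real.sin θ := by
      rw [← Real.cos_sub]; push_cast; ring_nf
    have e2 : Real.cos ((j + 1 : ℤ) * θ) =
        Real.cos (j * θ) * Real.cos θ - Real.sin (j * θ) * Real.sin θ := by
      rw [← Real.cos_add]; push_cast; ring_nf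
    simp only [e1, e2]
    rw [pow_succ]
    conv_lhs => rw [show arSymbol v ρ θ ^ q * arSymbol v ρ θ =
      arSymbol v ρ θ ^ q * (v⁻¹ * (1 + ρ ^ 2 - 2 * ρ * Real.cos θ)) from rfl]
    ring
  unfold symbolCoeff
  rw [h]
  ring

end Symbol

/-! ### Limiting spectral law by the method of moments. -/

section Moments

open Matrix

variable {v ρ : ℝ} {n : ℕ} {r : ℕ → ℝ}

/-- Far from the ends and from the breaks, the entries of the powers of `arMatrix` are those of the
powers of the bi-infinite Toeplitz matrix. -/
theorem arMatrix_pow_apply (q : ℕ) (t : Fin n) (h1 : q ≤ t) (h2 : t + q < n)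
    (hr : ∀ s, (t : ℕ) ≤ s + q → s ≤ t + 2 + q → r s = ρ) (s : Fin n) :
    (arMatrix v r n ^ q) t s = symbolCoeff v ρ q ((t : ℤ) - s) := by
  induction q generalizing t with
  | zero =>
    rw [pow_zero, symbolCoeff_zero, one_apply]
    congr 1
    rw [sub_eq_zero, Nat.cast_inj, Fin.ext_iff]
  | succ q ih =>
    set X : Fin n → ℝ := fun i => (arMatrix v r n ^ q) i s with hX
    have hmul : (arMatrix v r n ^ (q + 1)) t s = (arMatrix v r n *ᵥ X) t := by
      rw [pow_succ', Matrix.mul_apply]; rfl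
    have hXe : X = fun i : Fin n => extendZero X (i + 1) := by
      ext i; rw [extendZero_succ]
    -- A row involves only the neighbouring sites, so each further power widens the required clean
    -- zone by one.
    have hx : ∀ i : ℕ, i + 1 ≥ t → i ≤ t + 1 → (hi : i < n) →
        extendZero X (i + 1) = symbolCoeff v ρ q ((i : ℤ) - s) := by
      intro i hi1 hi2 hi
      have := extendZero_succ X ⟨i, hi⟩
      simp only at this
      rw [this, hX]
      exact ih ⟨i, hi⟩ (by simp only; omega) (by simp only; omega)
        (fun s' hs1 hs2 => hr s' (by simp only at hs1; omega) (by simp only at hs2; omega))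
    rw [hmul, hXe, arMatrix_mulVec_apply (extendZero_zero X), if_pos (by omega),
      hr (t + 1) (by omega) (by omega), hr (t + 2) (by omega) (by omega),
      hx t (by omega) (by omega) (by omega), hx (t + 1) (by omega) (by omega) (by omega)]
    obtain ⟨t', ht'⟩ : ∃ t' : ℕ, (t : ℕ) = t' + 1 := ⟨t - 1, by omega⟩
    rw [ht', hx t' (by omega) (by omega) (by omega), symbolCoeff_succ]
    push_cast
    rw [show (t' : ℤ) + 1 + 1 - s = t' + 1 - s + 1 by ring,
      show (t' : ℤ) - s = t' + 1 - s - 1 by ring]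
    ring

/-- At most `q` sites at each end and `2 q + 3` around each break are exceptional. The bound does
not depend on `n`, so these sites vanish in normalized traces. -/
theorem card_bad_le {m : ℕ} (k : Fin m → ℕ) (q : ℕ) :
    (Finset.univ.filter fun t : Fin n => ¬ (q ≤ t ∧ t + q < n ∧
      ∀ j, ¬ ((t : ℕ) ≤ k j + q ∧ k j ≤ t + 2 + q))).card ≤ 2 * q + m * (2 * q + 3) := by
  calc _ ≤ ((Finset.range q ∪ Finset.Ico (n - q) n) ∪
        Finset.univ.biUnion fun j => Finset.Icc (k j - 2 - q) (k j + q)).card := by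
        refine Finset.card_le_card_of_injOn (fun i => (i : ℕ)) (fun i hi => ?_)
          Fin.val_injective.injOn
        simp only [Finset.coe_filter, Finset.mem_univ, true_and, Set.mem_ofPred_eq] at hi
        simp only [Finset.mem_coe, Finset.mem_union, Finset.mem_range, Finset.mem_Ico,
          Finset.mem_biUnion, Finset.mem_univ, true_and, Finset.mem_Icc]
        by_cases h1 : q ≤ i
        · by_cases h2 : (i : ℕ) + q < n
          · right
            by_contra! hcon
            exact hi ⟨h1, h2, fun j hj => by
              have := hcon j (by omega)
              omega⟩
          · left; right; omega
        · left; left; omega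
    _ ≤ (q + q) + m * (2 * q + 3) := by
        refine (Finset.card_union_le _ _).trans (add_le_add ?_ ?_)
        · refine (Finset.card_union_le _ _).trans (add_le_add (by simp) ?_)
          rw [Nat.card_Ico]; omega
        · refine Finset.card_biUnion_le.trans ?_
          refine (Finset.sum_le_card_nsmul _ _ (2 * q + 3) fun j _ => ?_).trans (by simp)
          rw [Nat.card_Icc]; omega
    _ = _ := by ring

theorem tendsto_inv_mul_sum_of_card_bad {a : ∀ n, Fin n → ℝ} {c K : ℝ} {N : ℕ}
    (bad : ∀ n, Finset (Fin n)) (hN : ∀ n, (bad n).card ≤ N) (hgood : ∀ n, ∀ t ∉ bad n, a n t = c)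
    (hK : ∀ n t, |a n t - c| ≤ K) :
    Tendsto (fun n : ℕ => (n : ℝ)⁻¹ * ∑ t, a n t) atTop (𝓝 c) := by
  rw [tendsto_iff_norm_sub_tendsto_zero]
  have hlim : Tendsto (fun n : ℕ => (N * |K|) * (n : ℝ)⁻¹) atTop (𝓝 0) := by
    simpa using tendsto_inv_atTop_nhds_zero_nat.const_mul (N * |K|)
  refine squeeze_zero' (Eventually.of_forall fun n => norm_nonneg _) ?_ hlim
  filter_upwards [eventually_ge_atTop 1] with n hn
  have hn0 : (n : ℝ) ≠ 0 := by positivity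
  have h1 : (n : ℝ)⁻¹ * ∑ t, a n t - c = (n : ℝ)⁻¹ * ∑ t ∈ bad n, (a n t - c) := by
    have : ∑ t ∈ bad n, (a n t - c) = ∑ t, (a n t - c) :=
      Finset.sum_subset (Finset.subset_univ _) fun t _ ht => by rw [hgood n t ht, sub_self]
    rw [this, Finset.sum_sub_distrib]
    simp
    field_simp
  rw [h1, norm_mul, Real.norm_eq_abs, Real.norm_eq_abs, abs_of_nonneg (by positivity), mul_comm]
  refine mul_le_mul_of_nonneg_right ?_ (by positivity)
  calc |∑ t ∈ bad n, (a n t - c)| ≤ ∑ t ∈ bad n, |a n t - c| := Finset.abs_sum_le_sum_abs _ _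
    _ ≤ (bad n).card * |K| := by
        rw [← nsmul_eq_mul]
        exact Finset.sum_le_card_nsmul _ _ _ fun t _ => (hK n t).trans (le_abs_self K)
    _ ≤ _ := by
        have : ((bad n).card : ℝ) ≤ N := by exact_mod_cast hN n
        gcongr

/-- Moments give polynomials by linearity, and Weierstrass approximation on the common interval `[0,
C]` gives continuous functions. -/
theorem tendsto_mean_of_moments {d : ∀ n, Fin n → ℝ} {C : ℝ} (hd : ∀ n i, d n i ∈ Set.Icc 0 C)
    {g : ℝ → ℝ} (hg : Continuous g) (hgC : ∀ θ, g θ ∈ Set.Icc 0 C)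
    (hmom : ∀ q : ℕ, Tendsto (fun n : ℕ => (n : ℝ)⁻¹ * ∑ i, d n i ^ q) atTop
      (𝓝 ((2 * Real.pi)⁻¹ * ∫ θ in (0)..(2 * Real.pi), g θ ^ q)))
    {f : ℝ → ℝ} (hf : Continuous f) :
    Tendsto (fun n : ℕ => (n : ℝ)⁻¹ * ∑ i, f (d n i)) atTop
      (𝓝 ((2 * Real.pi)⁻¹ * ∫ θ in (0)..(2 * Real.pi), f (g θ))) := by
  have hpi : 0 < 2 * Real.pi := by positivity
  have hpoly : ∀ p : Polynomial ℝ, Tendsto (fun n : ℕ => (n : ℝ)⁻¹ * ∑ i, p.eval (d n i)) atTop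
      (𝓝 ((2 * Real.pi)⁻¹ * ∫ θ in (0)..(2 * Real.pi), p.eval (g θ))) := by
    intro p
    have h1 : (2 * Real.pi)⁻¹ * ∫ θ in (0)..(2 * Real.pi), p.eval (g θ) =
        ∑ q ∈ Finset.range (p.natDegree + 1), p.coeff q *
          ((2 * Real.pi)⁻¹ * ∫ θ in (0)..(2 * Real.pi), g θ ^ q) := by
      simp only [Polynomial.eval_eq_sum_range]
      rw [intervalIntegral.integral_finsetSum, Finset.mul_sum]
      · refine Finset.sum_congr rfl fun q _ => ?_
        rw [intervalIntegral.integral_const_mul]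
        ring
      · intro q _
        exact Continuous.intervalIntegrable (by fun_prop) _ _
    rw [h1]
    refine (tendsto_finsetSum _ fun q _ => (hmom q).const_mul (p.coeff q)).congr fun n => ?_
    simp only [Polynomial.eval_eq_sum_range]
    rw [Finset.sum_comm, Finset.mul_sum]
    refine Finset.sum_congr rfl fun q _ => ?_
    rw [← Finset.mul_sum]
    ring
  rw [Metric.tendsto_nhds]
  intro η hη
  obtain ⟨p, hp⟩ := exists_polynomial_near_of_continuousOn 0 C f hf.continuousOn (η / 3)
    (by positivity)
  have hint : |(2 * Real.pi)⁻¹ * (∫ θ in (0)..(2 * Real.pi), p.eval (g θ)) -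
      (2 * Real.pi)⁻¹ * ∫ θ in (0)..(2 * Real.pi), f (g θ)| ≤ η / 3 := by
    rw [← mul_sub, ← intervalIntegral.integral_sub
      (Continuous.intervalIntegrable (by fun_prop) _ _)
      (Continuous.intervalIntegrable (by fun_prop) _ _), abs_mul, abs_of_pos (inv_pos.mpr hpi)]
    have := intervalIntegral.norm_integral_le_of_norm_le_const (a := 0) (b := 2 * Real.pi)
      (f := fun θ => p.eval (g θ) - f (g θ)) (C := η / 3) (fun θ _ => (hp _ (hgC θ)).le)
    rw [sub_zero, abs_of_pos hpi, Real.norm_eq_abs] at this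
    rw [inv_mul_le_iff₀ hpi]
    linarith
  filter_upwards [(Metric.tendsto_nhds.mp (hpoly p)) (η / 3) (by positivity),
    eventually_ge_atTop 1] with n hn hn1
  rw [Real.dist_eq] at hn ⊢
  have hn0 : (0 : ℝ) < n := by positivity
  have hsum : |(n : ℝ)⁻¹ * ∑ i, f (d n i) - (n : ℝ)⁻¹ * ∑ i, p.eval (d n i)| ≤ η / 3 := by
    rw [← mul_sub, ← Finset.sum_sub_distrib, abs_mul, abs_of_pos (inv_pos.mpr hn0),
      inv_mul_le_iff₀ hn0]
    calc _ ≤ ∑ i, |f (d n i) - p.eval (d n i)| := Finset.abs_sum_le_sum_abs _ _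
      _ ≤ ∑ _i : Fin n, η / 3 := Finset.sum_le_sum fun i _ => by
          rw [abs_sub_comm]; exact (hp _ (hd n i)).le
      _ = _ := by simp
  rw [abs_le] at hint hsum
  rw [abs_lt] at hn ⊢
  constructor <;> linarith [hint.1, hint.2, hsum.1, hsum.2, hn.1, hn.2]

theorem integral_esd {A : Matrix (Fin n) (Fin n) ℝ} {d : Fin n → ℝ}
    (hr : A.charpoly.roots = Finset.univ.val.map d) (f : ℝ → ℝ) :
    ∫ x, f x ∂(esd A) = (n : ℝ)⁻¹ * ∑ i, f (d i) := by
  have : (A.charpoly.roots.map fun x => Measure.dirac x).sum = ∑ i, Measure.dirac (d i) := by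
    rw [hr, Multiset.map_map]; rfl
  rw [esd, integral_smul_measure, this, integral_finsetSum_measure]
  · simp
  · intro i _
    exact integrable_dirac (by simp)

/-- The precision matrices of the structural change model have the asymptotic spectral distribution
of the unperturbed autoregressive process. -/
theorem exists_isASD_arMatrix (hv : 0 < v) {m : ℕ} (ε : Fin m → ℝ) (k : ℕ → Fin m → ℕ) :
    ∃ μ : Measure ℝ, IsASD (fun n => arMatrix v (scmCoeff ρ ε (k n) (fun _ => 1)) n) μ ∧
      IsCompact μ.support ∧ μ.support ⊆ Set.Ici (v⁻¹ * (1 - |ρ|) ^ 2) := by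
  have hpi : 0 < 2 * Real.pi := by positivity
  set B : ∀ n, Matrix (Fin n) (Fin n) ℝ :=
    fun n => arMatrix v (scmCoeff ρ ε (k n) (fun _ => 1)) n with hB
  -- The limit law is the image under the symbol of the uniform law of the angle.
  set κ : Measure ℝ := ENNReal.ofReal (2 * Real.pi)⁻¹ • volume.restrict (Set.Ioc 0 (2 * Real.pi))
  have hκ : IsProbabilityMeasure κ := ⟨by
    simp only [κ, Measure.smul_apply, Measure.restrict_apply_univ, Real.volume_Ioc, smul_eq_mul,
      sub_zero]
    rw [← ENNReal.ofReal_mul (by positivity), inv_mul_cancel₀ hpi.ne', ENNReal.ofReal_one]⟩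
  have hsm := continuous_arSymbol v ρ
  have hsupp : (κ.map (arSymbol v ρ)).support ⊆
      Set.Icc (v⁻¹ * (1 - |ρ|) ^ 2) (v⁻¹ * (1 + |ρ|) ^ 2) := by
    refine Measure.support_subset_of_isClosed isClosed_Icc ?_
    exact (ae_map_iff hsm.aemeasurable measurableSet_Icc).mpr
      (Eventually.of_forall fun θ => arSymbol_mem_Icc hv ρ θ)
  refine ⟨κ.map (arSymbol v ρ), ⟨Measure.isProbabilityMeasure_map hsm.aemeasurable, fun f => ?_⟩,
    isCompact_Icc.of_isClosed_subset Measure.isClosed_support hsupp,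
    hsupp.trans Set.Icc_subset_Ici_self⟩
  choose U d hU hU' hUA hroots using
    fun n => exists_orthogonal_diagonalization (arMatrix_isHermitian v
      (scmCoeff ρ ε (k n) (fun _ => 1)) n)
  set R := |ρ| + ∑ j, |ε j| with hR
  set C := v⁻¹ * (2 + 2 * R ^ 2) with hC
  have hd : ∀ n i, d n i ∈ Set.Icc 0 C := fun n i =>
    mem_Icc_of_diagonalization (arMatrix_quadForm_nonneg hv)
      (arMatrix_quadForm_le hv (abs_scmCoeff_le ρ ε (k n))) (hU n) (hUA n) i
  have hgC : ∀ θ, arSymbol v ρ θ ∈ Set.Icc 0 C := by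
    intro θ
    have h := arSymbol_mem_Icc hv ρ θ
    refine ⟨le_trans (by positivity) h.1, h.2.trans ?_⟩
    refine mul_le_mul_of_nonneg_left ?_ (inv_nonneg.mpr hv.le)
    have h1 : |ρ| ≤ R := le_add_of_nonneg_right (Finset.sum_nonneg fun j _ => abs_nonneg _)
    have h2 : |ρ| ^ 2 ≤ R ^ 2 := pow_le_pow_left₀ (abs_nonneg _) h1 2
    nlinarith [sq_nonneg (1 - |ρ|)]
  have hmom : ∀ q : ℕ, Tendsto (fun n : ℕ => (n : ℝ)⁻¹ * ∑ i, d n i ^ q) atTop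
      (𝓝 ((2 * Real.pi)⁻¹ * ∫ θ in (0)..(2 * Real.pi), arSymbol v ρ θ ^ q)) := by
    intro q
    have hc : (2 * Real.pi)⁻¹ * ∫ θ in (0)..(2 * Real.pi), arSymbol v ρ θ ^ q =
        symbolCoeff v ρ q 0 := by simp [symbolCoeff]
    rw [hc]
    have htr : ∀ n, ∑ i, d n i ^ q = ∑ t, (B n ^ q) t t := fun n =>
      (trace_pow_of_diagonalization (hU n) (hU' n) (hUA n) q).symm
    simp only [htr]
    refine tendsto_inv_mul_sum_of_card_bad (K := C ^ q + |symbolCoeff v ρ q 0|) _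
      (fun n => card_bad_le (k n) q) ?_ ?_
    · intro n t ht
      simp only [Finset.mem_filter, Finset.mem_univ, true_and, not_not] at ht
      obtain ⟨h1, h2, h3⟩ := ht
      rw [hB, arMatrix_pow_apply (ρ := ρ) q t h1 h2, sub_self]
      intro s hs1 hs2
      refine scmCoeff_of_ne fun j hj => h3 j ?_
      omega
    · intro n t
      exact (abs_sub _ _).trans
        (add_le_add_left (abs_pow_apply_self_le (hU n) (hU' n) (hUA n) (hd n) q t) _)
  have hmap : ∫ x, f x ∂(κ.map (arSymbol v ρ)) =
      (2 * Real.pi)⁻¹ * ∫ θ in (0)..(2 * Real.pi), f (arSymbol v ρ θ) := by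
    rw [integral_map hsm.aemeasurable f.continuous.aestronglyMeasurable, integral_smul_measure,
      intervalIntegral.integral_of_le hpi.le, ENNReal.toReal_ofReal (by positivity), smul_eq_mul]
  rw [hmap]
  refine (tendsto_mean_of_moments hd hsm hgC hmom f.continuous).congr fun n => ?_
  exact (integral_esd (hroots n) f).symm

end Moments

/-! ### Recovering the magnitudes from the outliers. -/

theorem proposition4p1 {Ω : Type*} [MeasurableSpace Ω] (P : Measure Ω) [IsProbabilityMeasure P]
    (z : ℕ → Ω → ℝ) (v : ℝ) (hv : 0 < v) (hz : IsWhiteNoise P z v)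
    (ρ : ℝ) (hρ : |ρ| < 1) (hρ0 : ρ ≠ 0)
    (m₁ m₂ : ℕ) (ε₁ : Fin m₁ → ℝ) (ε₂ : Fin m₂ → ℝ)
    (hε₁ : ∀ j, ε₁ j ∈ magnitudes ρ) (hε₂ : ∀ j, ε₂ j ∈ magnitudes ρ)
    (k₁ : ℕ → Fin m₁ → ℕ) (k₂ : ℕ → Fin m₂ → ℕ)
    (hk₁ : WellSpaced k₁ (fun _ => 1)) (hk₂ : WellSpaced k₂ (fun _ => 1))
    (hout : out (scmPrecision P z ρ ε₁ k₁ (fun _ => 1)) =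
      out (scmPrecision P z ρ ε₂ k₂ (fun _ => 1))) :
    ∃ hm : m₁ = m₂, ∃ σ : Equiv.Perm (Fin m₁), ∀ j, ε₂ (Fin.cast hm j) = ε₁ (σ j) := by
  have hout' : ∀ {m : ℕ} {ε : Fin m → ℝ} {k : ℕ → Fin m → ℕ}, (∀ j, ε j ∈ magnitudes ρ) →
      WellSpaced k (fun _ => 1) → ∀ e ∈ magnitudes ρ,
      out (scmPrecision P z ρ ε k (fun _ => 1)) (lowOutlier v ρ e) =
        (Fintype.card {j // ε j = e} : ℕ∞) := by
    intro m ε k hε hk e he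
    have hB : scmPrecision P z ρ ε k (fun _ => 1) =
        fun n => arMatrix v (scmCoeff ρ ε (k n) (fun _ => 1)) n :=
      funext fun n => hz.precisionMatrix_arProcess hv _ n
    rw [hB]
    exact out_arMatrix_lowOutlier hv hρ hρ0 hε hk (exists_isASD_arMatrix hv ε k) he
  have hcard : ∀ e, Fintype.card {j // ε₁ j = e} = Fintype.card {j // ε₂ j = e} := by
    intro e
    by_cases he : e ∈ magnitudes ρ
    · have h := congrFun hout (lowOutlier v ρ e)
      rw [hout' hε₁ hk₁ e he, hout' hε₂ hk₂ e he] at h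
      exact_mod_cast h
    · have : IsEmpty {j // ε₁ j = e} := ⟨fun j => he (j.2 ▸ hε₁ j)⟩
      have : IsEmpty {j // ε₂ j = e} := ⟨fun j => he (j.2 ▸ hε₂ j)⟩
      rw [Fintype.card_eq_zero, Fintype.card_eq_zero]
  -- Bijections between the fibres of `ε₁` and `ε₂` glue to one of the index sets, which also forces
  -- `m₁ = m₂`.
  let τ : Fin m₁ ≃ Fin m₂ := Equiv.ofFiberEquiv fun e => Fintype.equivOfCardEq (hcard e)
  have hτ : ∀ j, ε₂ (τ j) = ε₁ j := Equiv.ofFiberEquiv_map _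
  obtain rfl : m₁ = m₂ := by simpa using Fintype.card_congr τ
  refine ⟨rfl, τ.symm, fun j => ?_⟩
  rw [← hτ, Equiv.apply_symm_apply]
  rfl
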